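/- Let $X$ be a random vector in $\mathbb{R}^n$ and, for every $t>0$, let $Z_t\sim\mathcal N(0,tI_n)$ be independent of $X$. Write $I(\cdot\,;\cdot)$ for mutual information in nats, $J(U)=\mathbb{E}\,\|\nabla\log p_U(U)\|^2$ for the Fisher information of a random vector $U$ with continuously differentiable density $p_U$, and $\operatorname{Cov}(U)$ for the covariance matrix. (a) Suppose $\mathbb{E}\|X\|^2<\infty$, let $Y_t=X+Z_t$ and $\mathrm{mmse}(t)=\mathbb{E}\,\|X-\mathbb{E}[X\mid Y_t]\|^2$. Then for every $t>0$ the vector $Y_t$ has a positive continuously differentiable density, $J(Y_t)<\infty$, and $$0\le \frac nt-J(Y_t)=\frac{\mathrm{mmse}(t)}{t^2}\le\frac{\operatorname{tr}\operatorname{Cov}(X)}{t^2}.$$ Moreover, for every $T>0$, $I(X;Y_T)$ is finite, $t\mapsto \frac nt-J(Y_t)$ is integrable on $(T,\infty)$, and $$I(X;Y_T)=\frac12\int_T^\infty\Bigl(\frac nt-J(Y_t)\Bigr)\,dt .$$ (b) Let $f:\mathbb{R}^n\to\mathbb{R}^n$ be measurable, $W=f(X)$ and $Y_t=W+Z_t$.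 Then $I(X;Y_t)=I(W;Y_t)$ for every $t>0$. If moreover $\mathbb{E}\|W\|^2<\infty$ (no moment of $X$ is required), then for every $t>0$ the vector $Y_t$ has a positive continuously differentiable density, $J(Y_t)<\infty$, and $$0\le \frac nt-J(Y_t)=\frac{\mathbb{E}\,\|W-\mathbb{E}[W\mid Y_t]\|^2}{t^2}\le\frac{\operatorname{tr}\operatorname{Cov}(W)}{t^2},$$ and for every $T>0$, $I(X;Y_T)$ is finite, $t\mapsto \frac nt-J(Y_t)$ is integrable on $(T,\infty)$, and $$I(X;Y_T)=\frac12\int_T^\infty\Bigl(\frac nt-J(Y_t)\Bigr)\,dt .$$ -/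

import Mathlib

open MeasureTheory ProbabilityTheory InformationTheory Set

noncomputable section

/-- Mutual information `I(U;V)` in nats: the Kullback–Leibler divergence of the joint law of
`(U, V)` from the product of the marginal laws. -/
def mutualInfo {Ω α β : Type*} [MeasurableSpace Ω] [MeasurableSpace α] [MeasurableSpace β]
    (U : Ω → α) (V : Ω → β) (μ : Measure Ω) : ENNReal :=
  klDiv (μ.map (fun ω => (U ω, V ω))) ((μ.map U).prod (μ.map V))

/-- `p` is a continuously differentiable probability density of the law `ν` with respect to
Lebesgue measure. Such a `p` is unique, since two continuous densities agree everywhere. -/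
structure IsC1Density {n : ℕ} (ν : Measure (EuclideanSpace ℝ (Fin n)))
    (p : EuclideanSpace ℝ (Fin n) → ℝ) : Prop where
  contDiff : ContDiff ℝ 1 p
  nonneg : ∀ y, 0 ≤ p y
  eq_withDensity : ν = volume.withDensity (fun y => ENNReal.ofReal (p y))

open Classical in
/-- The continuously differentiable density of `ν` (and `0` if there is none). -/
def density {n : ℕ} (ν : Measure (EuclideanSpace ℝ (Fin n))) : EuclideanSpace ℝ (Fin n) → ℝ :=
  if h : ∃ p, IsC1Density ν p then h.choose else 0

/-- The score function `∇ log p` of a law with density `p`. -/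
def score {n : ℕ} (ν : Measure (EuclideanSpace ℝ (Fin n))) (y : EuclideanSpace ℝ (Fin n)) :
    EuclideanSpace ℝ (Fin n) :=
  gradient (fun z => Real.log (density ν z)) y

/-- The scalar Fisher information `J(U) = 𝔼 ‖∇ log p_U(U)‖²` of the random vector `U`. -/
def fisherInfo {Ω : Type*} [MeasurableSpace Ω] {n : ℕ}
    (U : Ω → EuclideanSpace ℝ (Fin n)) (μ : Measure Ω) : ℝ :=
  ∫ y, ‖score (μ.map U) y‖ ^ 2 ∂(μ.map U)

/-- `𝔼 ‖U - 𝔼[U | V]‖²`, the minimum mean-square error of estimating `U` from `V`. -/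
def mmse {Ω : Type*} [MeasurableSpace Ω] {n : ℕ}
    (U V : Ω → EuclideanSpace ℝ (Fin n)) (μ : Measure Ω) : ℝ :=
  ∫ ω, ‖U ω - (μ[U | MeasurableSpace.comap V inferInstance]) ω‖ ^ 2 ∂μ

/-- The covariance matrix of a random vector. -/
def covMat {Ω : Type*} [MeasurableSpace Ω] {n : ℕ}
    (U : Ω → EuclideanSpace ℝ (Fin n)) (μ : Measure Ω) : Matrix (Fin n) (Fin n) ℝ :=
  Matrix.of fun i j => covariance (fun ω => U ω i) (fun ω => U ω j) μ

/-- The law of `U` has an everywhere positive `C¹` density, so that its score is defined at every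
point, and the score is square integrable: `J(U)` is well defined and finite. -/
def HasFiniteFisherInfo {Ω : Type*} [MeasurableSpace Ω] {n : ℕ}
    (U : Ω → EuclideanSpace ℝ (Fin n)) (μ : Measure Ω) : Prop :=
  IsC1Density (μ.map U) (density (μ.map U)) ∧ (∀ y, 0 < density (μ.map U) y) ∧
    Integrable (fun y => ‖score (μ.map U) y‖ ^ 2) (μ.map U)

end

/-! Let `W` be the channel input, `p_t` the density of `Y_t = W + Z_t`, and `s_t = ∇ log p_t`. Two
classical facts drive everything.

Tweedie's formula: differentiating the Gaussian kernel under the integral shows that the conditional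
mean of `W` given `Y_t = y` is `m(y) = y + t s_t(y)`. Hence `Z_t = -(W - m(Y_t)) - t s_t(Y_t)`,
where the first summand has conditional mean zero given `Y_t`. Taking energies gives `n t = mmse +
t² J(Y_t)`, which is the pointwise identity (`integral_posterior_variance`,
`condExp_eq_posteriorMean`). The trace bound holds because the posterior mean is at least as good an
estimator as the constant `𝔼 W`.

De Bruijn's identity: `p_t` solves `∂_t p = ½ Δp`, so integration by parts gives `d/dt ∫ p_t log p_t
= -½ J(Y_t)` (`hasDerivAt_integral_heatDensity_mul_log`). The log-likelihood ratio of the channel is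
explicit, and its mean is `I(W; Y_t) = -∫ p_t log p_t - (n/2) log (2πet)`
(`mutualInfo_add_ne_top_and_toReal`). Therefore `I' = -½ (n/t - J)`, which is nonpositive by the
first fact. Jensen's inequality for `log p_t` gives `I(W; Y_t) ≤ tr Cov(W) / t`, so `I → 0` at
infinity. The fundamental theorem of calculus for a monotone function on a half-line then gives
integrability and the formula together.

For `W = f(X)`, the likelihood ratio of `(X, Y_t)` depends on `X` only through `f(X)`. The two
divergences are then the same integral (`mutualInfo_comp_eq`), which needs no moments, and the
second half reduces to the first with `W` as input.

The analytic estimates rest on two bounds: polynomial factors are absorbed by a kernel of larger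
variance, and `|log p_t|` grows at most quadratically, locally uniformly in `t`. Hence second
moments suffice for every interchange of limits and integrals. -/

/-- The density of `N(0, t I)` on Euclidean space. -/
noncomputable def heatKernel {n : ℕ} (t : ℝ) (z : EuclideanSpace ℝ (Fin n)) : ℝ :=
  (2 * Real.pi * t) ^ (-(n : ℝ) / 2) * Real.exp (-‖z‖ ^ 2 / (2 * t))

/-! ### The Gaussian kernel: bounds, derivatives, moments, Green's identity. -/

section heatKernel

variable {n : ℕ} {t : ℝ}

lemma heatKernel_pos (ht : 0 < t) (z : EuclideanSpace ℝ (Fin n)) : 0 < heatKernel t z := by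
  unfold heatKernel; positivity

lemma continuous_heatKernel (t : ℝ) :
    Continuous (heatKernel t : EuclideanSpace ℝ (Fin n) → ℝ) := by
  unfold heatKernel; fun_prop

lemma heatKernel_le (ht : 0 < t) (z : EuclideanSpace ℝ (Fin n)) :
    heatKernel t z ≤ (2 * Real.pi * t) ^ (-(n : ℝ) / 2) := by
  unfold heatKernel
  refine mul_le_of_le_one_right (by positivity) (Real.exp_le_one_iff.2 ?_)
  exact div_nonpos_of_nonpos_of_nonneg (by simp) (by positivity)

lemma log_heatKernel (ht : 0 < t) (z : EuclideanSpace ℝ (Fin n)) :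
    Real.log (heatKernel t z) = -(n : ℝ) / 2 * Real.log (2 * Real.pi * t) - ‖z‖ ^ 2 / (2 * t) := by
  unfold heatKernel
  rw [Real.log_mul (by positivity) (by positivity), Real.log_exp, Real.log_rpow (by positivity)]
  ring

lemma heatKernel_neg (t : ℝ) (z : EuclideanSpace ℝ (Fin n)) :
    heatKernel t (-z) = heatKernel t z := by
  simp [heatKernel]

/-- Polynomial weights are absorbed by doubling the variance, uniformly for times in `[a, b]`. -/
lemma heatKernel_mul_le {a b : ℝ} (ha : 0 < a) (hta : a ≤ t) (htb : t ≤ b)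
    (z : EuclideanSpace ℝ (Fin n)) :
    (1 + ‖z‖ ^ 2) * heatKernel t z ≤
      ((2 * Real.pi * a) ^ (-(n : ℝ) / 2) / (2 * Real.pi * (2 * b)) ^ (-(n : ℝ) / 2) * (1 + 4 * b)) *
        heatKernel (2 * b) z := by
  have ht : 0 < t := ha.trans_le hta
  have hb : 0 < b := ht.trans_le htb
  have h1 : (2 * Real.pi * t) ^ (-(n : ℝ) / 2) ≤ (2 * Real.pi * a) ^ (-(n : ℝ) / 2) := by
    apply Real.rpow_le_rpow_of_nonpos (by positivity) (by gcongr)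
    exact div_nonpos_of_nonpos_of_nonneg (by simp) (by positivity)
  -- The decay rate is at least `1 / (2b) = 1 / (4b) + 1 / (4b)`: one half pays for the polynomial,
  -- the other is the kernel at time `2b`.
  have h2 : Real.exp (-‖z‖ ^ 2 / (2 * t)) ≤
      Real.exp (-‖z‖ ^ 2 / (4 * b)) * Real.exp (-‖z‖ ^ 2 / (2 * (2 * b))) := by
    rw [← Real.exp_add]
    apply Real.exp_le_exp.2
    have : ‖z‖ ^ 2 / (2 * b) ≤ ‖z‖ ^ 2 / (2 * t) := by gcongr
    have e : -‖z‖ ^ 2 / (4 * b) + -‖z‖ ^ 2 / (2 * (2 * b)) = -(‖z‖ ^ 2 / (2 * b)) := by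
      field_simp; ring
    rw [e, neg_div]; linarith
  have h3 : (1 + ‖z‖ ^ 2) * Real.exp (-‖z‖ ^ 2 / (4 * b)) ≤ 1 + 4 * b := by
    rw [neg_div, Real.exp_neg, ← div_eq_mul_inv, div_le_iff₀ (Real.exp_pos _)]
    have := Real.add_one_le_exp (‖z‖ ^ 2 / (4 * b))
    have h5 : ‖z‖ ^ 2 = 4 * b * (‖z‖ ^ 2 / (4 * b)) := by field_simp
    have h4 : 0 ≤ ‖z‖ ^ 2 / (4 * b) := by positivity
    set s := ‖z‖ ^ 2 / (4 * b)
    rw [h5]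
    nlinarith
  unfold heatKernel
  calc (1 + ‖z‖ ^ 2) * ((2 * Real.pi * t) ^ (-(n : ℝ) / 2) * Real.exp (-‖z‖ ^ 2 / (2 * t)))
      ≤ (1 + ‖z‖ ^ 2) * ((2 * Real.pi * a) ^ (-(n : ℝ) / 2) *
        (Real.exp (-‖z‖ ^ 2 / (4 * b)) * Real.exp (-‖z‖ ^ 2 / (2 * (2 * b))))) := by gcongr
    _ = (2 * Real.pi * a) ^ (-(n : ℝ) / 2) * ((1 + ‖z‖ ^ 2) * Real.exp (-‖z‖ ^ 2 / (4 * b))) *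
        Real.exp (-‖z‖ ^ 2 / (2 * (2 * b))) := by ring
    _ ≤ (2 * Real.pi * a) ^ (-(n : ℝ) / 2) * (1 + 4 * b) *
        Real.exp (-‖z‖ ^ 2 / (2 * (2 * b))) := by gcongr
    _ = _ := by
      have : (2 * Real.pi * (2 * b)) ^ (-(n : ℝ) / 2) ≠ 0 := by positivity
      field_simp

lemma exists_heatKernel_mul_le (ht : 0 < t) :
    ∃ C : ℝ, 0 ≤ C ∧ ∀ z : EuclideanSpace ℝ (Fin n), (1 + ‖z‖ ^ 2) * heatKernel t z ≤ C := by
  refine ⟨_, ?_, fun z => (heatKernel_mul_le ht le_rfl le_rfl z).trans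
    (mul_le_mul_of_nonneg_left (heatKernel_le (by positivity) z) (by positivity))⟩
  positivity

lemma integrable_heatKernel (ht : 0 < t) :
    Integrable (heatKernel t : EuclideanSpace ℝ (Fin n) → ℝ) := by
  have h := GaussianFourier.integrable_cexp_neg_mul_sq_norm_add (V := EuclideanSpace ℝ (Fin n))
    (b := ((1 / (2 * t) : ℝ) : ℂ)) (by rw [Complex.ofReal_re]; positivity) 0 0
  have h2 := (h.norm).const_mul ((2 * Real.pi * t) ^ (-(n : ℝ) / 2))
  refine h2.congr (Filter.Eventually.of_forall fun z => ?_)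
  simp only [heatKernel, Complex.norm_exp]
  congr 2
  simp [← Complex.ofReal_pow, -Complex.ofReal_div, -Complex.ofReal_inv,
    -Complex.ofReal_mul]
  ring

lemma integral_heatKernel (ht : 0 < t) :
    ∫ z : EuclideanSpace ℝ (Fin n), heatKernel t z = 1 := by
  have h := GaussianFourier.integral_rexp_neg_mul_sq_norm (V := EuclideanSpace ℝ (Fin n))
    (b := 1 / (2 * t)) (by positivity)
  have e : ∀ z : EuclideanSpace ℝ (Fin n), heatKernel t z =
      (2 * Real.pi * t) ^ (-(n : ℝ) / 2) * Real.exp (-(1 / (2 * t)) * ‖z‖ ^ 2) := by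
    intro z; unfold heatKernel; congr 2; ring
  simp_rw [e]
  rw [integral_const_mul, h, finrank_euclideanSpace, Fintype.card_fin,
    show Real.pi / (1 / (2 * t)) = 2 * Real.pi * t by field_simp, ← Real.rpow_add (by positivity)]
  ring_nf
  simp

lemma integrable_heatKernel_mul_norm_sq (ht : 0 < t) :
    Integrable (fun z : EuclideanSpace ℝ (Fin n) => (1 + ‖z‖ ^ 2) * heatKernel t z) := by
  refine ((integrable_heatKernel (by positivity : 0 < 2 * t)).const_mul
    ((2 * Real.pi * t) ^ (-(n : ℝ) / 2) / (2 * Real.pi * (2 * t)) ^ (-(n : ℝ) / 2) *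
      (1 + 4 * t))).mono' (by have := continuous_heatKernel (n := n) t; fun_prop) (Filter.Eventually.of_forall fun z => ?_)
  rw [Real.norm_of_nonneg (by have := heatKernel_pos ht z; positivity)]
  exact heatKernel_mul_le ht le_rfl le_rfl z

lemma hasFDerivAt_heatKernel (ht : 0 < t) (z : EuclideanSpace ℝ (Fin n)) :
    HasFDerivAt (heatKernel t) (-(heatKernel t z / t) • innerSL ℝ z) z := by
  have h1 : HasFDerivAt (fun z : EuclideanSpace ℝ (Fin n) => ‖z‖ ^ 2) (2 • innerSL ℝ z) z :=
    (hasStrictFDerivAt_norm_sq z).hasFDerivAt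
  have h2 := ((h1.const_mul (-1 / (2 * t))).exp).const_mul ((2 * Real.pi * t) ^ (-(n : ℝ) / 2))
  have e : (heatKernel t : EuclideanSpace ℝ (Fin n) → ℝ) = fun z =>
      (2 * Real.pi * t) ^ (-(n : ℝ) / 2) * Real.exp (-1 / (2 * t) * ‖z‖ ^ 2) := by
    ext z; unfold heatKernel; congr 2; ring
  rw [e]
  refine h2.congr_fderiv ?_
  ext v
  simp
  field_simp

lemma hasFDerivAt_heatKernel_sub (ht : 0 < t) (w y : EuclideanSpace ℝ (Fin n)) :
    HasFDerivAt (fun y => heatKernel t (y - w))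
      (-(heatKernel t (y - w) / t) • innerSL ℝ (y - w)) y := by
  refine ((hasFDerivAt_heatKernel ht (y - w)).comp y
    ((hasFDerivAt_id y).sub_const w)).congr_fderiv ?_
  ext v
  simp

lemma hasDerivAt_heatKernel (ht : 0 < t) (z : EuclideanSpace ℝ (Fin n)) :
    HasDerivAt (fun s => heatKernel s z)
      (heatKernel t z * (‖z‖ ^ 2 / (2 * t ^ 2) - n / (2 * t))) t := by
  have h1 : HasDerivAt (fun s : ℝ => 2 * Real.pi * s) (2 * Real.pi) t := by
    simpa using (hasDerivAt_id t).const_mul (2 * Real.pi)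
  have h2 := h1.rpow_const (p := -(n : ℝ) / 2) (Or.inl (by positivity))
  have h3 : HasDerivAt (fun s : ℝ => -‖z‖ ^ 2 / (2 * s)) (‖z‖ ^ 2 / (2 * t ^ 2)) t := by
    have := (((hasDerivAt_id t).const_mul (2 : ℝ)).fun_inv (by positivity)).const_mul (-‖z‖ ^ 2)
    simp only [id] at this
    refine this.congr_deriv ?_
    field_simp
  refine (h2.mul h3.exp).congr_deriv ?_
  unfold heatKernel
  rw [Real.rpow_sub_one (by positivity)]
  field_simp
  ring

/-- Green's identity for the Gaussian density. -/
lemma integral_heatKernel_mul_eq (ht : 0 < t) (w : EuclideanSpace ℝ (Fin n))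
    {u : EuclideanSpace ℝ (Fin n) → ℝ} {u' : EuclideanSpace ℝ (Fin n) → EuclideanSpace ℝ (Fin n)}
    (hu : ∀ y, HasGradientAt u (u' y) y)
    (hu_int : Integrable (fun y => (1 + ‖y - w‖ ^ 2) * heatKernel t (y - w) * u y))
    (hu'_meas : Measurable u')
    (hu'_int : Integrable (fun y => heatKernel t (y - w) * (‖y - w‖ * ‖u' y‖))) :
    ∫ y, heatKernel t (y - w) * (n - ‖y - w‖ ^ 2 / t) * u y =
      -∫ y, heatKernel t (y - w) * inner ℝ (y - w) (u' y) := by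
  have hg : ∀ y, HasFDerivAt (fun y => heatKernel t (y - w))
      (-(heatKernel t (y - w) / t) • innerSL ℝ (y - w)) y := hasFDerivAt_heatKernel_sub ht w
  have hpos : ∀ y, 0 < heatKernel t (y - w) := fun y => heatKernel_pos ht _
  have hgc : Continuous fun y => heatKernel t (y - w) :=
    (continuous_heatKernel t).comp (continuous_id.sub continuous_const)
  have huc : Continuous u := continuous_iff_continuousAt.2 fun y => (hu y).continuousAt
  have hc : ∀ (i : Fin n) y, HasFDerivAt (fun y : EuclideanSpace ℝ (Fin n) => (y - w) i)
      (EuclideanSpace.proj i : EuclideanSpace ℝ (Fin n) →L[ℝ] ℝ) y := fun i y => by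
    simpa using ((EuclideanSpace.proj i : EuclideanSpace ℝ (Fin n) →L[ℝ] ℝ).hasFDerivAt
      (x := y)).sub_const (w i)
  have hf := fun i y => (hg y).mul (hc i y)
  -- Summed over `i`, these derivatives form the divergence `g (n - ‖y - w‖² / t)` of the field `g
  -- (y - w)`, `g` being the kernel; the identity is integration by parts against this field.
  have hfe : ∀ i y, fderiv ℝ (fun y => heatKernel t (y - w) * (y - w) i) y
      (EuclideanSpace.single i 1) = heatKernel t (y - w) * (1 - (y - w) i ^ 2 / t) := by
    intro i y
    rw [show (fun y => heatKernel t (y - w) * (y - w) i) =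
      (fun y => heatKernel t (y - w)) * (fun y => (y - w) i) from rfl, (hf i y).fderiv]
    simp [EuclideanSpace.inner_single_right]
    ring
  have hue : ∀ i y, fderiv ℝ u y (EuclideanSpace.single i 1) = u' y i := by
    intro i y
    rw [(hu y).hasFDerivAt.fderiv]
    simp [EuclideanSpace.inner_single_right]
  have hcoord : ∀ (i : Fin n) (z : EuclideanSpace ℝ (Fin n)), |z i| ≤ ‖z‖ := fun i z => by
    simpa using PiLp.norm_apply_le z i
  have I1 : ∀ i, Integrable fun y => heatKernel t (y - w) * (1 - (y - w) i ^ 2 / t) * u y := by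
    intro i
    refine (hu_int.norm.const_mul (1 + 1 / t)).mono' (by fun_prop)
      (Filter.Eventually.of_forall fun y => ?_)
    rw [norm_mul, norm_mul, norm_mul, norm_mul, ← mul_assoc]
    refine mul_le_mul_of_nonneg_right ?_ (norm_nonneg _)
    rw [mul_comm, ← mul_assoc]
    refine mul_le_mul_of_nonneg_right ?_ (norm_nonneg _)
    rw [Real.norm_eq_abs, Real.norm_eq_abs, abs_of_pos (by positivity : 0 < 1 + ‖y - w‖ ^ 2)]
    have h1 : (y - w) i ^ 2 ≤ ‖y - w‖ ^ 2 := sq_le_sq' (abs_le.1 (hcoord i _)).1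
      (abs_le.1 (hcoord i _)).2
    have h2 : (y - w) i ^ 2 / t ≤ ‖y - w‖ ^ 2 / t := by gcongr
    have h3 : 0 ≤ (y - w) i ^ 2 / t := by positivity
    have h4 : (1 + 1 / t) * (1 + ‖y - w‖ ^ 2) = 1 + 1 / t + ‖y - w‖ ^ 2 + ‖y - w‖ ^ 2 / t := by
      field_simp
      ring
    have h5 : 0 < 1 / t := by positivity
    rw [h4, abs_le]
    constructor <;> nlinarith [sq_nonneg ‖y - w‖]
  have I2 : ∀ i, Integrable fun y => heatKernel t (y - w) * (y - w) i * u' y i := by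
    intro i
    refine hu'_int.mono' (by fun_prop) (Filter.Eventually.of_forall fun y => ?_)
    rw [norm_mul, norm_mul, Real.norm_of_nonneg (hpos y).le, mul_assoc]
    have := (hpos y).le
    gcongr
    · exact hcoord i _
    · exact hcoord i _
  have I3 : ∀ i, Integrable fun y => heatKernel t (y - w) * (y - w) i * u y := by
    intro i
    refine hu_int.norm.mono' (by fun_prop) (Filter.Eventually.of_forall fun y => ?_)
    rw [norm_mul, norm_mul, norm_mul, norm_mul]
    refine mul_le_mul_of_nonneg_right ?_ (norm_nonneg _)
    rw [mul_comm]
    refine mul_le_mul_of_nonneg_right ?_ (norm_nonneg _)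
    rw [Real.norm_eq_abs, Real.norm_eq_abs, abs_of_pos (by positivity : 0 < 1 + ‖y - w‖ ^ 2)]
    have := hcoord i (y - w)
    nlinarith [sq_nonneg (‖y - w‖ - 1)]
  have key : ∀ i, ∫ y, heatKernel t (y - w) * (y - w) i * u' y i =
      -∫ y, heatKernel t (y - w) * (1 - (y - w) i ^ 2 / t) * u y := by
    intro i
    have := integral_mul_fderiv_eq_neg_fderiv_mul_of_integrable (μ := volume)
      (f := fun y => heatKernel t (y - w) * (y - w) i) (g := u) (v := EuclideanSpace.single i 1)
      (by simpa only [hfe] using I1 i) (by simpa only [hue] using I2 i) (I3 i)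
      (fun y _ => (hf i y).differentiableAt) (fun y _ => (hu y).differentiableAt)
    simpa only [hfe, hue] using this
  have e1 : ∀ y, heatKernel t (y - w) * (n - ‖y - w‖ ^ 2 / t) * u y =
      ∑ i, heatKernel t (y - w) * (1 - (y - w) i ^ 2 / t) * u y := by
    intro y
    rw [← Finset.sum_mul, ← Finset.mul_sum, Finset.sum_sub_distrib, ← Finset.sum_div,
      EuclideanSpace.real_norm_sq_eq]
    simp
  have e2 : ∀ y, heatKernel t (y - w) * inner ℝ (y - w) (u' y) =
      ∑ i, heatKernel t (y - w) * (y - w) i * u' y i := by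
    intro y
    simp_rw [mul_assoc]
    rw [← Finset.mul_sum, PiLp.inner_apply]
    congr 1
    refine Finset.sum_congr rfl fun i _ => ?_
    simp [mul_comm]
  simp_rw [e1, e2]
  rw [integral_finsetSum _ fun i _ => I1 i, integral_finsetSum _ fun i _ => I2 i,
    ← Finset.sum_neg_distrib]
  exact Finset.sum_congr rfl fun i _ => by rw [key, neg_neg]

/-- Green's identity with `u = 1`: the gradient side vanishes and the other side contains the second
moment. -/
lemma integral_heatKernel_mul_norm_sq (ht : 0 < t) :
    ∫ z : EuclideanSpace ℝ (Fin n), heatKernel t z * ‖z‖ ^ 2 = n * t := by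
  have hi := integrable_heatKernel_mul_norm_sq (n := n) ht
  have h := integral_heatKernel_mul_eq (n := n) ht 0 (u := fun _ => 1) (u' := fun _ => 0)
    (fun y => by simpa using hasGradientAt_const y (1 : ℝ)) (by simpa using hi)
    measurable_const (by simp)
  have h1 : Integrable fun z : EuclideanSpace ℝ (Fin n) => heatKernel t z * ‖z‖ ^ 2 := by
    refine (hi.sub (integrable_heatKernel ht)).congr (Filter.Eventually.of_forall fun z => ?_)
    simp only [Pi.sub_apply]
    ring
  have h2 : ∀ z : EuclideanSpace ℝ (Fin n), heatKernel t z * (n - ‖z‖ ^ 2 / t) =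
      n * heatKernel t z - t⁻¹ * (heatKernel t z * ‖z‖ ^ 2) := fun z => by
    field_simp
  simp only [sub_zero, mul_one, inner_zero_right, mul_zero, integral_zero, neg_zero, h2] at h
  rw [integral_sub ((integrable_heatKernel ht).const_mul _) (h1.const_mul _), integral_const_mul,
    integral_const_mul, integral_heatKernel ht] at h
  field_simp at h
  linarith

lemma integrable_heatKernel_mul {F : Type*} [NormedAddCommGroup F] [NormedSpace ℝ F] (ht : 0 < t)
    {v : EuclideanSpace ℝ (Fin n) → F} (hv : AEStronglyMeasurable v volume) {C : ℝ}
    (hC : ∀ z, ‖v z‖ ≤ C * (1 + ‖z‖ ^ 2)) :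
    Integrable fun z => heatKernel t z • v z := by
  refine ((integrable_heatKernel_mul_norm_sq (n := n) ht).const_mul C).mono'
    (by have := continuous_heatKernel (n := n) t; fun_prop) (Filter.Eventually.of_forall fun z => ?_)
  rw [norm_smul, Real.norm_of_nonneg (heatKernel_pos ht z).le, ← mul_assoc,
    mul_comm (heatKernel t z)]
  exact mul_le_mul_of_nonneg_right (hC z) (heatKernel_pos ht z).le

/-- The integrand is odd. -/
lemma integral_heatKernel_mul_inner (t : ℝ) (x : EuclideanSpace ℝ (Fin n)) :
    ∫ z : EuclideanSpace ℝ (Fin n), heatKernel t z * inner ℝ z x = 0 := by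
  have h := integral_neg_eq_self
    (fun z : EuclideanSpace ℝ (Fin n) => heatKernel t z * inner ℝ z x) volume
  simp only [heatKernel_neg, inner_neg_left, mul_neg, integral_neg] at h
  linarith

lemma integral_heatKernel_mul_norm_add_sq (ht : 0 < t) (x : EuclideanSpace ℝ (Fin n)) :
    ∫ z : EuclideanSpace ℝ (Fin n), heatKernel t z * ‖z + x‖ ^ 2 = n * t + ‖x‖ ^ 2 := by
  have h1 : Integrable fun z : EuclideanSpace ℝ (Fin n) => heatKernel t z * ‖z‖ ^ 2 :=
    integrable_heatKernel_mul ht (by fun_prop) (C := 1) fun z => by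
      rw [Real.norm_of_nonneg (by positivity)]; linarith
  have h2 : Integrable fun z : EuclideanSpace ℝ (Fin n) => heatKernel t z * inner ℝ z x :=
    integrable_heatKernel_mul ht (by fun_prop) (C := ‖x‖) fun z => by
      refine (norm_inner_le_norm z x).trans ?_
      rw [mul_comm]
      gcongr
      nlinarith [sq_nonneg (‖z‖ - 1)]
  have e : ∀ z : EuclideanSpace ℝ (Fin n), heatKernel t z * ‖z + x‖ ^ 2 =
      heatKernel t z * ‖z‖ ^ 2 + 2 * (heatKernel t z * inner ℝ z x) +
        heatKernel t z * ‖x‖ ^ 2 := fun z => by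
    rw [norm_add_sq_real]; ring
  simp_rw [e]
  rw [integral_add (h1.fun_add (h2.const_mul 2)) ((integrable_heatKernel ht).mul_const _),
    integral_add h1 (h2.const_mul 2), integral_const_mul, integral_mul_const,
    integral_heatKernel ht, integral_heatKernel_mul_norm_sq ht, integral_heatKernel_mul_inner]
  ring

lemma isProbabilityMeasure_heatKernel (ht : 0 < t) : IsProbabilityMeasure
    ((volume : Measure (EuclideanSpace ℝ (Fin n))).withDensity
      fun z => ENNReal.ofReal (heatKernel t z)) := by
  constructor
  rw [withDensity_apply _ MeasurableSet.univ, Measure.restrict_univ,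
    ← ofReal_integral_eq_lintegral_ofReal (integrable_heatKernel ht)
      (Filter.Eventually.of_forall fun z => (heatKernel_pos ht z).le), integral_heatKernel ht,
    ENNReal.ofReal_one]

/-- Both sides have characteristic function `exp (-t ‖x‖² / 2)`. This ties the abstract noise law to
the explicit kernel. -/
lemma multivariateGaussian_smul_one_eq_withDensity (ht : 0 < t) :
    multivariateGaussian 0 (t • (1 : Matrix (Fin n) (Fin n) ℝ)) =
      volume.withDensity fun z => ENNReal.ofReal (heatKernel t z) := by
  have := isProbabilityMeasure_heatKernel (n := n) ht
  apply Measure.ext_of_charFun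
  ext x
  rw [charFun_multivariateGaussian (Matrix.PosSemidef.one.smul ht.le), charFun_apply,
    integral_withDensity_eq_integral_toReal_smul
      (continuous_heatKernel t).measurable.ennreal_ofReal (by simp)]
  have h := GaussianFourier.integral_cexp_neg_mul_sq_norm_add (V := EuclideanSpace ℝ (Fin n))
    (b := ((1 / (2 * t) : ℝ) : ℂ)) (by rw [Complex.ofReal_re]; positivity) Complex.I x
  have e : ∀ z : EuclideanSpace ℝ (Fin n), (ENNReal.ofReal (heatKernel t z)).toReal •
      Complex.exp (inner ℝ z x * Complex.I) = (((2 * Real.pi * t) ^ (-(n : ℝ) / 2) : ℝ) : ℂ) *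
      Complex.exp (-((1 / (2 * t) : ℝ) : ℂ) * ‖z‖ ^ 2 + Complex.I * inner ℝ x z) := by
    intro z
    rw [ENNReal.toReal_ofReal (heatKernel_pos ht z).le, heatKernel, Complex.real_smul,
      Complex.exp_add, Complex.ofReal_mul, Complex.ofReal_exp, real_inner_comm, mul_assoc,
      mul_comm Complex.I]
    congr 3
    push_cast
    ring_nf
  simp_rw [e]
  rw [integral_const_mul, h, finrank_euclideanSpace, Fintype.card_fin,
    ← Complex.ofReal_div, show Real.pi / (1 / (2 * t)) = 2 * Real.pi * t by field_simp,
    show ((n : ℂ) / 2) = (((n : ℝ) / 2 : ℝ) : ℂ) by push_cast; rfl,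
    ← Complex.ofReal_cpow (by positivity), ← mul_assoc, ← Complex.ofReal_mul,
    ← Real.rpow_add (by positivity)]
  rw [show -(n : ℝ) / 2 + n / 2 = 0 by ring]
  simp only [Real.rpow_zero, Complex.ofReal_one, one_mul]
  congr 1
  have hx : (x.ofLp ⬝ᵥ x.ofLp : ℝ) = ‖x‖ ^ 2 := by
    rw [EuclideanSpace.real_norm_sq_eq]; simp [dotProduct, sq]
  simp [Matrix.smul_mulVec, hx]
  field_simp
  ring

end heatKernel

/-! ### The smoothed density: regularity, Tweedie's formula, logarithmic bounds. -/

/-- The density of the convolution of `ν` with `N(0, t I)`. -/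
noncomputable def heatDensity {n : ℕ} (ν : Measure (EuclideanSpace ℝ (Fin n))) (t : ℝ)
    (y : EuclideanSpace ℝ (Fin n)) : ℝ :=
  ∫ w, heatKernel t (y - w) ∂ν

/-- The spatial gradient of `heatDensity ν t`. -/
noncomputable def heatGradient {n : ℕ} (ν : Measure (EuclideanSpace ℝ (Fin n))) (t : ℝ)
    (y : EuclideanSpace ℝ (Fin n)) : EuclideanSpace ℝ (Fin n) :=
  ∫ w, -(heatKernel t (y - w) / t) • (y - w) ∂ν

/-- The gradient of the logarithm of `heatDensity ν t`. -/
noncomputable def heatScore {n : ℕ} (ν : Measure (EuclideanSpace ℝ (Fin n))) (t : ℝ)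
    (y : EuclideanSpace ℝ (Fin n)) : EuclideanSpace ℝ (Fin n) :=
  (heatDensity ν t y)⁻¹ • heatGradient ν t y

/-- The time derivative of `heatDensity ν t`. -/
noncomputable def heatTimeDeriv {n : ℕ} (ν : Measure (EuclideanSpace ℝ (Fin n))) (t : ℝ)
    (y : EuclideanSpace ℝ (Fin n)) : ℝ :=
  ∫ w, heatKernel t (y - w) * (‖y - w‖ ^ 2 / (2 * t ^ 2) - n / (2 * t)) ∂ν

/-- The conditional mean of the signal given the observation `y` in the Gaussian channel with
noise variance `t`. -/
noncomputable def posteriorMean {n : ℕ} (ν : Measure (EuclideanSpace ℝ (Fin n))) (t : ℝ)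
    (y : EuclideanSpace ℝ (Fin n)) : EuclideanSpace ℝ (Fin n) :=
  y + (t / heatDensity ν t y) • heatGradient ν t y

section heatDensity

variable {n : ℕ} {t : ℝ} {ν : Measure (EuclideanSpace ℝ (Fin n))} [IsProbabilityMeasure ν]

lemma continuous_heatKernel_sub_left (t : ℝ) (y : EuclideanSpace ℝ (Fin n)) :
    Continuous fun w => heatKernel t (y - w) :=
  (continuous_heatKernel t).comp (continuous_const.sub continuous_id)

/-- For fixed `y`, the kernel turns quadratic growth in `y - w` into a bounded function, so no
moment of `ν` enters. -/
lemma integrable_heatKernel_sub_smul {F : Type*} [NormedAddCommGroup F] [NormedSpace ℝ F]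
    (ht : 0 < t) (y : EuclideanSpace ℝ (Fin n))
    {v : EuclideanSpace ℝ (Fin n) → F} (hv : AEStronglyMeasurable v ν) {C : ℝ}
    (hC : ∀ w, ‖v w‖ ≤ C * (1 + ‖y - w‖ ^ 2)) :
    Integrable (fun w => heatKernel t (y - w) • v w) ν := by
  obtain ⟨K, hK0, hK⟩ := exists_heatKernel_mul_le (n := n) ht
  refine (integrable_const (|C| * K)).mono'
    ((continuous_heatKernel_sub_left t y).aestronglyMeasurable.smul hv)
    (Filter.Eventually.of_forall fun w => ?_)
  have hp := heatKernel_pos ht (y - w)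
  rw [norm_smul, Real.norm_of_nonneg hp.le]
  calc heatKernel t (y - w) * ‖v w‖ ≤ heatKernel t (y - w) * (|C| * (1 + ‖y - w‖ ^ 2)) := by
        gcongr
        refine (hC w).trans ?_
        gcongr
        exact le_abs_self C
    _ = |C| * ((1 + ‖y - w‖ ^ 2) * heatKernel t (y - w)) := by ring
    _ ≤ |C| * K := by gcongr; exact hK _

lemma integrable_heatKernel_sub (ht : 0 < t) (y : EuclideanSpace ℝ (Fin n)) :
    Integrable (fun w => heatKernel t (y - w)) ν := by
  simpa using integrable_heatKernel_sub_smul (ν := ν) ht y (v := fun _ => (1 : ℝ)) (by fun_prop)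
    (C := 1) fun w => by rw [norm_one]; nlinarith [sq_nonneg ‖y - w‖]

lemma heatDensity_pos (ht : 0 < t) (y : EuclideanSpace ℝ (Fin n)) : 0 < heatDensity ν t y := by
  unfold heatDensity
  rw [integral_pos_iff_support_of_nonneg (fun w => (heatKernel_pos ht _).le)
    (integrable_heatKernel_sub ht y)]
  rw [show Function.support (fun w => heatKernel t (y - w)) = univ from
    Set.eq_univ_of_forall fun w => (heatKernel_pos ht _).ne']
  simp

/-- The spatial derivative of the kernel is bounded by a constant, uniformly in both points, and a
constant is a valid dominating function for a probability measure. -/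
lemma hasGradientAt_heatDensity (ht : 0 < t) (y : EuclideanSpace ℝ (Fin n)) :
    HasGradientAt (heatDensity ν t) (heatGradient ν t y) y := by
  obtain ⟨K, hK0, hK⟩ := exists_heatKernel_mul_le (n := n) ht
  have hb : ∀ w x : EuclideanSpace ℝ (Fin n),
      ‖-(heatKernel t (x - w) / t) • innerSL ℝ (x - w)‖ ≤ K / t := by
    intro w x
    have hp := heatKernel_pos ht (x - w)
    rw [norm_smul, norm_neg, norm_div, Real.norm_of_nonneg hp.le, Real.norm_of_nonneg ht.le,
      innerSL_apply_norm, div_mul_eq_mul_div]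
    gcongr
    refine le_trans ?_ (hK (x - w))
    rw [mul_comm]
    gcongr
    nlinarith [sq_nonneg (‖x - w‖ - 1)]
  have h := hasFDerivAt_integral_of_dominated_of_fderiv_le (μ := ν) (s := univ) (x₀ := y)
    (F := fun x w => heatKernel t (x - w))
    (F' := fun x w => -(heatKernel t (x - w) / t) • innerSL ℝ (x - w))
    (bound := fun _ => K / t) Filter.univ_mem
    (Filter.Eventually.of_forall fun x =>
      (continuous_heatKernel_sub_left t x).aestronglyMeasurable)
    (integrable_heatKernel_sub ht y)
    (by
      have := continuous_heatKernel_sub_left t y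
      exact Continuous.aestronglyMeasurable (by fun_prop))
    (Filter.Eventually.of_forall fun w x _ => hb w x) (integrable_const _)
    (Filter.Eventually.of_forall fun w x _ => hasFDerivAt_heatKernel_sub ht w x)
  rw [hasGradientAt_iff_hasFDerivAt]
  refine h.congr_fderiv ?_
  have hi : Integrable (fun w => -(heatKernel t (y - w) / t) • (y - w)) ν := by
    refine (integrable_const (K / t)).mono' ?_ (Filter.Eventually.of_forall fun w => ?_)
    · have := continuous_heatKernel_sub_left t y
      exact Continuous.aestronglyMeasurable (by fun_prop)
    · have := hb w y
      rw [norm_smul, innerSL_apply_norm] at this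
      rwa [norm_smul]
  have h2 := (innerSL ℝ (E := EuclideanSpace ℝ (Fin n))).integral_comp_comm hi
  unfold heatGradient
  ext v
  rw [InnerProductSpace.toDual_apply_apply, ← innerSL_apply_apply ℝ, ← h2]
  simp

lemma continuous_heatDensity (ht : 0 < t) : Continuous (heatDensity ν t) :=
  continuous_iff_continuousAt.2 fun y => (hasGradientAt_heatDensity ht y).continuousAt

lemma continuous_heatGradient (ht : 0 < t) : Continuous (heatGradient ν t) := by
  obtain ⟨K, hK0, hK⟩ := exists_heatKernel_mul_le (n := n) ht
  refine continuous_of_dominated (bound := fun _ => K / t) (fun x => ?_)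
    (fun x => Filter.Eventually.of_forall fun w => ?_) (integrable_const _)
    (Filter.Eventually.of_forall fun w => ?_)
  · have := continuous_heatKernel_sub_left t x
    exact Continuous.aestronglyMeasurable (by fun_prop)
  · have hp := heatKernel_pos ht (x - w)
    rw [norm_smul, norm_neg, norm_div, Real.norm_of_nonneg hp.le, Real.norm_of_nonneg ht.le,
      div_mul_eq_mul_div]
    gcongr
    refine le_trans ?_ (hK (x - w))
    rw [mul_comm]
    gcongr
    nlinarith [sq_nonneg (‖x - w‖ - 1)]
  · have : Continuous fun x => heatKernel t (x - w) :=
      (continuous_heatKernel t).comp (continuous_id.sub continuous_const)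
    fun_prop

lemma contDiff_heatDensity (ht : 0 < t) : ContDiff ℝ 1 (heatDensity ν t) := by
  rw [contDiff_one_iff_fderiv]
  refine ⟨fun y => (hasGradientAt_heatDensity ht y).differentiableAt, ?_⟩
  rw [show fderiv ℝ (heatDensity ν t) = fun y =>
    InnerProductSpace.toDual ℝ (EuclideanSpace ℝ (Fin n)) (heatGradient ν t y) from
    funext fun y => (hasGradientAt_heatDensity ht y).hasFDerivAt.fderiv]
  exact (LinearIsometryEquiv.continuous _).comp (continuous_heatGradient ht)

lemma hasGradientAt_log_heatDensity (ht : 0 < t) (y : EuclideanSpace ℝ (Fin n)) :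
    HasGradientAt (fun z => Real.log (heatDensity ν t z))
      (heatScore ν t y) y := by
  rw [hasGradientAt_iff_hasFDerivAt]
  refine ((hasGradientAt_heatDensity ht y).hasFDerivAt.log
    (heatDensity_pos ht y).ne').congr_fderiv ?_
  simp [heatScore]

lemma continuous_heatScore (ht : 0 < t) : Continuous (heatScore ν t) :=
  ((continuous_heatDensity ht).inv₀ fun y => (heatDensity_pos ht y).ne').smul
    (continuous_heatGradient ht)

lemma continuous_posteriorMean (ht : 0 < t) : Continuous (posteriorMean ν t) := by
  unfold posteriorMean
  exact continuous_id.add ((continuous_const.div (continuous_heatDensity ht)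
    fun y => (heatDensity_pos ht y).ne').smul (continuous_heatGradient ht))

lemma integrable_heatKernel_sub_smul_id (ht : 0 < t) (y c : EuclideanSpace ℝ (Fin n)) :
    Integrable (fun w => heatKernel t (y - w) • (w - c)) ν := by
  refine integrable_heatKernel_sub_smul ht y (by fun_prop) (C := 1 + ‖y - c‖) fun w => ?_
  have h1 : ‖w - c‖ ≤ ‖y - c‖ + ‖y - w‖ := by
    rw [show w - c = (y - c) - (y - w) by abel]
    exact norm_sub_le _ _
  nlinarith [sq_nonneg (‖y - w‖ - 1), norm_nonneg (y - w), norm_nonneg (y - c),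
    mul_nonneg (norm_nonneg (y - c)) (sq_nonneg ‖y - w‖)]

lemma integrable_heatKernel_sub_mul_norm_sq (ht : 0 < t) (y c : EuclideanSpace ℝ (Fin n)) :
    Integrable (fun w => heatKernel t (y - w) * ‖w - c‖ ^ 2) ν := by
  refine integrable_heatKernel_sub_smul (F := ℝ) ht y (by fun_prop)
    (C := 2 + 2 * ‖y - c‖ ^ 2) fun w => ?_
  have h1 : ‖w - c‖ ≤ ‖y - c‖ + ‖y - w‖ := by
    rw [show w - c = (y - c) - (y - w) by abel]
    exact norm_sub_le _ _
  rw [Real.norm_of_nonneg (by positivity)]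
  nlinarith [sq_nonneg (‖y - w‖ - ‖y - c‖), norm_nonneg (y - w), norm_nonneg (y - c),
    norm_nonneg (w - c), mul_nonneg (sq_nonneg ‖y - c‖) (sq_nonneg ‖y - w‖)]

lemma heatGradient_eq (ν : Measure (EuclideanSpace ℝ (Fin n))) (t : ℝ)
    (y : EuclideanSpace ℝ (Fin n)) :
    heatGradient ν t y = t⁻¹ • ∫ w, heatKernel t (y - w) • (w - y) ∂ν := by
  unfold heatGradient
  rw [← integral_smul]
  refine integral_congr_ae (Filter.Eventually.of_forall fun w => ?_)
  simp only [smul_smul]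
  rw [← neg_sub w y, smul_neg, neg_smul, neg_neg]
  ring_nf

/-- Tweedie's formula: `t ∇p(y)` is the kernel-weighted integral of `w - y`, so the barycentre of
the posterior is `y + t ∇p(y) / p(y)`. -/
lemma integral_heatKernel_smul_sub_posteriorMean (ht : 0 < t) (y : EuclideanSpace ℝ (Fin n)) :
    ∫ w, heatKernel t (y - w) • (w - posteriorMean ν t y) ∂ν = 0 := by
  have h := heatGradient_eq ν t y
  have hp := heatDensity_pos (ν := ν) ht y
  have e : ∀ w, heatKernel t (y - w) • (w - posteriorMean ν t y) =
      heatKernel t (y - w) • (w - y) -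
        heatKernel t (y - w) • (t / heatDensity ν t y) • heatGradient ν t y := by
    intro w
    rw [posteriorMean, ← smul_sub]
    congr 1
    abel
  simp_rw [e]
  rw [integral_sub (integrable_heatKernel_sub_smul_id ht y y)
    ((integrable_heatKernel_sub ht y).smul_const _), integral_smul_const]
  change _ - heatDensity ν t y • _ = _
  rw [h, smul_smul, smul_smul, mul_div_cancel₀ _ hp.ne', mul_inv_cancel₀ ht.ne', one_smul, sub_self]

/-- The bias–variance decomposition of the posterior. -/
lemma integral_heatKernel_mul_norm_sub_sq (ht : 0 < t) (y c : EuclideanSpace ℝ (Fin n)) :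
    ∫ w, heatKernel t (y - w) * ‖w - c‖ ^ 2 ∂ν =
      ∫ w, heatKernel t (y - w) * ‖w - posteriorMean ν t y‖ ^ 2 ∂ν +
        heatDensity ν t y * ‖posteriorMean ν t y - c‖ ^ 2 := by
  set m := posteriorMean ν t y with hm
  have h1 := integrable_heatKernel_sub_smul_id (ν := ν) ht y m
  have h0 := integral_heatKernel_smul_sub_posteriorMean (ν := ν) ht y
  have h2 := integral_inner (𝕜 := ℝ) h1 (m - c)
  have h3 := h1.const_inner (𝕜 := ℝ) (m - c)
  rw [← hm] at h0
  rw [h0, inner_zero_right] at h2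
  have e : ∀ w, heatKernel t (y - w) * ‖w - c‖ ^ 2 = heatKernel t (y - w) * ‖w - m‖ ^ 2 +
      2 * inner ℝ (m - c) (heatKernel t (y - w) • (w - m)) +
      heatKernel t (y - w) * ‖m - c‖ ^ 2 := by
    intro w
    rw [show w - c = (w - m) + (m - c) by abel, norm_add_sq_real, inner_smul_right,
      real_inner_comm]
    ring
  simp_rw [e]
  rw [integral_add ((integrable_heatKernel_sub_mul_norm_sq ht y m).fun_add (h3.const_mul 2))
    ((integrable_heatKernel_sub ht y).mul_const _),
    integral_add (integrable_heatKernel_sub_mul_norm_sq ht y m) (h3.const_mul 2),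
    integral_const_mul, integral_mul_const, h2]
  simp [heatDensity]

/-- The bias–variance decomposition centred at `y`, where the bias is exactly `t` times the score.
Integrated over `y`, it becomes the relation between mmse and Fisher information. -/
lemma integral_heatKernel_mul_norm_sq_eq_add_heatScore (ht : 0 < t)
    (y : EuclideanSpace ℝ (Fin n)) :
    ∫ w, heatKernel t (y - w) * ‖y - w‖ ^ 2 ∂ν =
      ∫ w, heatKernel t (y - w) * ‖w - posteriorMean ν t y‖ ^ 2 ∂ν +
        t ^ 2 * (heatDensity ν t y * ‖heatScore ν t y‖ ^ 2) := by
  have h := integral_heatKernel_mul_norm_sub_sq (ν := ν) ht y y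
  simp_rw [norm_sub_rev _ y] at h
  rw [norm_sub_rev y (posteriorMean ν t y)] at h
  rw [h, heatScore, posteriorMean, add_sub_cancel_left, div_eq_mul_inv, ← smul_smul, norm_smul,
    Real.norm_of_nonneg ht.le]
  ring

lemma heatDensity_le (ht : 0 < t) (y : EuclideanSpace ℝ (Fin n)) :
    heatDensity ν t y ≤ (2 * Real.pi * t) ^ (-(n : ℝ) / 2) := by
  simpa [heatDensity] using integral_mono (μ := ν) (integrable_heatKernel_sub ht y)
    (integrable_const _) fun w => heatKernel_le ht (y - w)

lemma log_heatDensity_le (ht : 0 < t) (y : EuclideanSpace ℝ (Fin n)) :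
    Real.log (heatDensity ν t y) ≤ -(n : ℝ) / 2 * Real.log (2 * Real.pi * t) := by
  rw [← Real.log_rpow (by positivity)]
  exact Real.log_le_log (heatDensity_pos ht y) (heatDensity_le ht y)

lemma integrable_norm_sub_sq (hν : Integrable (fun w => ‖w‖ ^ 2) ν)
    (y : EuclideanSpace ℝ (Fin n)) : Integrable (fun w => ‖y - w‖ ^ 2) ν := by
  refine ((integrable_const (2 * ‖y‖ ^ 2)).add (hν.const_mul 2)).mono' (by fun_prop)
    (Filter.Eventually.of_forall fun w => ?_)
  rw [Real.norm_of_nonneg (by positivity)]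
  have := norm_sub_le y w
  simp only [Pi.add_apply]
  nlinarith [sq_nonneg (‖y‖ - ‖w‖), norm_nonneg (y - w), norm_nonneg y, norm_nonneg w]

/-- Jensen's inequality for `exp`: the logarithm of the average kernel is at least the average of
its logarithm. -/
lemma le_log_heatDensity (hν : Integrable (fun w => ‖w‖ ^ 2) ν) (ht : 0 < t)
    (y : EuclideanSpace ℝ (Fin n)) :
    -(n : ℝ) / 2 * Real.log (2 * Real.pi * t) - (∫ w, ‖y - w‖ ^ 2 ∂ν) / (2 * t) ≤
      Real.log (heatDensity ν t y) := by
  have hi := (integrable_norm_sub_sq hν y).neg.div_const (2 * t)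
  have hexp : Integrable (fun w => Real.exp (-‖y - w‖ ^ 2 / (2 * t))) ν := by
    refine ((integrable_heatKernel_sub (ν := ν) ht y).const_mul
      ((2 * Real.pi * t) ^ (-(n : ℝ) / 2))⁻¹).congr (Filter.Eventually.of_forall fun w => ?_)
    have : (2 * Real.pi * t) ^ (-(n : ℝ) / 2) ≠ 0 := by positivity
    simp only [heatKernel]
    field_simp
  have h := convexOn_exp.map_integral_le (μ := ν) (f := fun w => -‖y - w‖ ^ 2 / (2 * t))
    Real.continuous_exp.continuousOn isClosed_univ (by simp) hi hexp
  have e : heatDensity ν t y = (2 * Real.pi * t) ^ (-(n : ℝ) / 2) *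
      ∫ w, Real.exp (-‖y - w‖ ^ 2 / (2 * t)) ∂ν := by
    rw [heatDensity, ← integral_const_mul]; rfl
  have h1 := Real.log_le_log (by positivity)
    (mul_le_mul_of_nonneg_left h (by positivity : 0 ≤ (2 * Real.pi * t) ^ (-(n : ℝ) / 2)))
  rw [← e, Real.log_mul (by positivity) (by positivity), Real.log_exp,
    Real.log_rpow (by positivity), integral_div, integral_neg] at h1
  rw [sub_eq_add_neg, ← neg_div]
  exact h1

/-- The maximum of the kernel bounds the logarithm above and Jensen's inequality bounds it below.
Uniformity in `t` is what differentiating the entropy requires. -/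
lemma exists_abs_log_heatDensity_le (hν : Integrable (fun w => ‖w‖ ^ 2) ν) {a b : ℝ} (ha : 0 < a) :
    ∃ C, 0 ≤ C ∧ ∀ t ∈ Icc a b, ∀ y, |Real.log (heatDensity ν t y)| ≤ C * (1 + ‖y‖ ^ 2) := by
  set M := ∫ w, ‖w‖ ^ 2 ∂ν
  have hM : 0 ≤ M := integral_nonneg fun w => by positivity
  set K := (n : ℝ) / 2 * (|Real.log (2 * Real.pi * a)| + |Real.log (2 * Real.pi * b)|)
  have hK : 0 ≤ K := by positivity
  refine ⟨K + (1 + M) / a, by positivity, fun t ht y => ?_⟩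
  have ht0 : 0 < t := ha.trans_le ht.1
  have hlog : |-(n : ℝ) / 2 * Real.log (2 * Real.pi * t)| ≤ K := by
    rw [abs_mul, neg_div, abs_neg, abs_of_nonneg (by positivity : 0 ≤ (n : ℝ) / 2)]
    refine mul_le_mul_of_nonneg_left ?_ (by positivity)
    have h1 : Real.log (2 * Real.pi * a) ≤ Real.log (2 * Real.pi * t) :=
      Real.log_le_log (by positivity) (by have := ht.1; gcongr)
    have h2 : Real.log (2 * Real.pi * t) ≤ Real.log (2 * Real.pi * b) :=
      Real.log_le_log (by positivity) (by have := ht.2; gcongr)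
    rw [abs_le]
    constructor
    · linarith [neg_abs_le (Real.log (2 * Real.pi * a)), abs_nonneg (Real.log (2 * Real.pi * b))]
    · linarith [le_abs_self (Real.log (2 * Real.pi * b)), abs_nonneg (Real.log (2 * Real.pi * a))]
  have hq : (∫ w, ‖y - w‖ ^ 2 ∂ν) / (2 * t) ≤ (1 + M) / a * (1 + ‖y‖ ^ 2) := by
    have h1 : ∫ w, ‖y - w‖ ^ 2 ∂ν ≤ 2 * (‖y‖ ^ 2 + M) := by
      have := integral_mono (integrable_norm_sub_sq hν y)
        ((integrable_const (2 * ‖y‖ ^ 2)).add (hν.const_mul 2)) (fun w => by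
          have := norm_sub_le y w
          simp only [Pi.add_apply]
          nlinarith [sq_nonneg (‖y‖ - ‖w‖), norm_nonneg (y - w), norm_nonneg y, norm_nonneg w])
      rw [integral_add' (integrable_const _) (hν.const_mul 2),
        integral_const_mul 2 fun w => ‖w‖ ^ 2] at this
      simp only [integral_const, probReal_univ, one_smul] at this
      linarith
    calc (∫ w, ‖y - w‖ ^ 2 ∂ν) / (2 * t) ≤ 2 * (‖y‖ ^ 2 + M) / (2 * a) := by
          have := ht.1; gcongr
      _ = (‖y‖ ^ 2 + M) / a := by field_simp
      _ ≤ (1 + M) * (1 + ‖y‖ ^ 2) / a := by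
          gcongr
          nlinarith [mul_nonneg hM (sq_nonneg ‖y‖)]
      _ = _ := by ring
  have hl := log_heatDensity_le (ν := ν) ht0 y
  have hg := le_log_heatDensity hν ht0 y
  have hKy : K ≤ K * (1 + ‖y‖ ^ 2) := le_mul_of_one_le_right hK (by nlinarith [sq_nonneg ‖y‖])
  have hM' : 0 ≤ (1 + M) / a * (1 + ‖y‖ ^ 2) := by positivity
  rw [abs_le] at hlog ⊢
  constructor <;> linarith [hlog.1, hlog.2]

lemma exists_abs_heatKernel_timeDeriv_le {a b : ℝ} (ha : 0 < a) :
    ∃ C, 0 ≤ C ∧ ∀ t ∈ Icc a b, ∀ z : EuclideanSpace ℝ (Fin n),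
      |heatKernel t z * (‖z‖ ^ 2 / (2 * t ^ 2) - n / (2 * t))| ≤ C * heatKernel (2 * b) z := by
  by_cases hb : 0 < b
  swap
  · exact ⟨0, le_rfl, fun t ht => absurd (ha.trans_le (ht.1.trans ht.2)) hb⟩
  refine ⟨(1 / (2 * a ^ 2) + n / (2 * a)) * ((2 * Real.pi * a) ^ (-(n : ℝ) / 2) /
    (2 * Real.pi * (2 * b)) ^ (-(n : ℝ) / 2) * (1 + 4 * b)), by positivity, fun t ht z => ?_⟩
  · have ht0 : 0 < t := ha.trans_le ht.1
    have hat := ht.1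
    have hp := heatKernel_pos ht0 z
    have h1 : |‖z‖ ^ 2 / (2 * t ^ 2) - n / (2 * t)| ≤
        (1 / (2 * a ^ 2) + n / (2 * a)) * (1 + ‖z‖ ^ 2) := by
      have h2 : ‖z‖ ^ 2 / (2 * t ^ 2) ≤ ‖z‖ ^ 2 / (2 * a ^ 2) := by gcongr
      have h3 : n / (2 * t) ≤ n / (2 * a) := by gcongr
      have h4 : 0 ≤ ‖z‖ ^ 2 / (2 * t ^ 2) := by positivity
      have h5 : 0 ≤ n / (2 * t) := by positivity
      have h6 : 0 ≤ n / (2 * a) * ‖z‖ ^ 2 := by positivity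
      have h7 : 0 ≤ 1 / (2 * a ^ 2) := by positivity
      have h8 : (1 / (2 * a ^ 2) + n / (2 * a)) * (1 + ‖z‖ ^ 2) = 1 / (2 * a ^ 2) +
        ‖z‖ ^ 2 / (2 * a ^ 2) + n / (2 * a) + n / (2 * a) * ‖z‖ ^ 2 := by ring
      rw [h8, abs_le]
      constructor <;> linarith
    rw [abs_mul, abs_of_pos hp]
    calc heatKernel t z * |‖z‖ ^ 2 / (2 * t ^ 2) - n / (2 * t)|
        ≤ heatKernel t z * ((1 / (2 * a ^ 2) + n / (2 * a)) * (1 + ‖z‖ ^ 2)) := by gcongr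
      _ = (1 / (2 * a ^ 2) + n / (2 * a)) * ((1 + ‖z‖ ^ 2) * heatKernel t z) := by ring
      _ ≤ (1 / (2 * a ^ 2) + n / (2 * a)) * _ :=
          mul_le_mul_of_nonneg_left (heatKernel_mul_le ha ht.1 ht.2 z) (by positivity)
      _ = _ := (mul_assoc _ _ _).symm

lemma exists_abs_heatTimeDeriv_le (ν : Measure (EuclideanSpace ℝ (Fin n)))
    [IsProbabilityMeasure ν] {a b : ℝ} (ha : 0 < a) :
    ∃ C, 0 ≤ C ∧ ∀ t ∈ Icc a b, ∀ y, |heatTimeDeriv ν t y| ≤ C * heatDensity ν (2 * b) y := by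
  obtain ⟨C, hC0, hC⟩ := exists_abs_heatKernel_timeDeriv_le (n := n) (b := b) ha
  refine ⟨C, hC0, fun t ht y => ?_⟩
  have hb : 0 < 2 * b := by linarith [ht.1, ht.2]
  rw [heatDensity, ← integral_const_mul, ← Real.norm_eq_abs, heatTimeDeriv]
  exact norm_integral_le_of_norm_le ((integrable_heatKernel_sub hb y).const_mul C)
    (Filter.Eventually.of_forall fun w => hC t ht (y - w))

lemma hasDerivAt_heatDensity (ht : 0 < t) (y : EuclideanSpace ℝ (Fin n)) :
    HasDerivAt (fun s => heatDensity ν s y) (heatTimeDeriv ν t y) t := by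
  -- On the window `[t/2, 2t]` all time derivatives are dominated by the kernel at time `4t`.
  obtain ⟨C, -, hC⟩ := exists_abs_heatKernel_timeDeriv_le (n := n) (a := t / 2) (b := 2 * t)
    (by positivity)
  refine (hasDerivAt_integral_of_dominated_loc_of_deriv_le (μ := ν)
    (F := fun s w => heatKernel s (y - w))
    (F' := fun s w => heatKernel s (y - w) * (‖y - w‖ ^ 2 / (2 * s ^ 2) - n / (2 * s)))
    (bound := fun w => C * heatKernel (2 * (2 * t)) (y - w))
    (Icc_mem_nhds (by linarith : t / 2 < t) (by linarith : t < 2 * t))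
    (Filter.Eventually.of_forall fun s =>
      (continuous_heatKernel_sub_left s y).aestronglyMeasurable)
    (integrable_heatKernel_sub ht y) ?_
    (Filter.Eventually.of_forall fun w s hs => hC s hs (y - w))
    ((integrable_heatKernel_sub (by positivity) y).const_mul C)
    (Filter.Eventually.of_forall fun w s hs =>
      hasDerivAt_heatKernel (by linarith [hs.1]) (y - w))).2
  have := continuous_heatKernel_sub_left t y
  exact Continuous.aestronglyMeasurable (by fun_prop)

end heatDensity

/-! ### Integrals over input and output together; energy splitting and de Bruijn's identity. -/

section joint

variable {n : ℕ} {t : ℝ} {ν : Measure (EuclideanSpace ℝ (Fin n))} [IsProbabilityMeasure ν]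

lemma continuous_heatKernel_snd_sub_fst (t : ℝ) :
    Continuous fun q : EuclideanSpace ℝ (Fin n) × EuclideanSpace ℝ (Fin n) =>
      heatKernel t (q.2 - q.1) :=
  (continuous_heatKernel t).comp (continuous_snd.sub continuous_fst)

/-- The shear `(w, y) ↦ (w, y - w)` preserves `ν × volume` and decouples signal from noise, so the
dominating function becomes a product of two integrable factors. -/
lemma integrable_prod_heatKernel_smul {F : Type*} [NormedAddCommGroup F] [NormedSpace ℝ F]
    (hν : Integrable (fun w => ‖w‖ ^ 2) ν) (ht : 0 < t)
    {v : EuclideanSpace ℝ (Fin n) × EuclideanSpace ℝ (Fin n) → F}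
    (hv : AEStronglyMeasurable v (ν.prod volume)) {C : ℝ}
    (hC : ∀ q, ‖v q‖ ≤ C * ((1 + ‖q.1‖ ^ 2) * (1 + ‖q.2 - q.1‖ ^ 2))) :
    Integrable (fun q => heatKernel t (q.2 - q.1) • v q) (ν.prod volume) := by
  have h0 := ((integrable_const (1 : ℝ)).add hν).mul_prod
    (integrable_heatKernel_mul_norm_sq (n := n) ht)
  have h1 := (measurePreserving_prod_neg_add ν
    (volume : Measure (EuclideanSpace ℝ (Fin n)))).integrable_comp_of_integrable h0
  refine (h1.const_mul C).mono'
    ((continuous_heatKernel_snd_sub_fst t).aestronglyMeasurable.smul hv)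
    (Filter.Eventually.of_forall fun q => ?_)
  have hp := heatKernel_pos ht (q.2 - q.1)
  rw [norm_smul, Real.norm_of_nonneg hp.le]
  simp only [Function.comp_apply, Pi.add_apply, neg_add_eq_sub]
  calc heatKernel t (q.2 - q.1) * ‖v q‖
      ≤ heatKernel t (q.2 - q.1) * (C * ((1 + ‖q.1‖ ^ 2) * (1 + ‖q.2 - q.1‖ ^ 2))) := by
        gcongr
        exact hC q
    _ = _ := by ring

lemma integrable_prod_heatKernel_mul_norm_sq (hν : Integrable (fun w => ‖w‖ ^ 2) ν) (ht : 0 < t) :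
    Integrable (fun q : EuclideanSpace ℝ (Fin n) × EuclideanSpace ℝ (Fin n) =>
      heatKernel t (q.2 - q.1) * ‖q.2 - q.1‖ ^ 2) (ν.prod volume) := by
  refine integrable_prod_heatKernel_smul (F := ℝ) hν ht (by fun_prop) (C := 1) fun q => ?_
  rw [Real.norm_of_nonneg (by positivity)]
  nlinarith [mul_nonneg (sq_nonneg ‖q.1‖) (sq_nonneg ‖q.2 - q.1‖), sq_nonneg ‖q.1‖]

lemma integrable_prod_heatKernel_mul_one_add (hν : Integrable (fun w => ‖w‖ ^ 2) ν) (ht : 0 < t) :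
    Integrable (fun q : EuclideanSpace ℝ (Fin n) × EuclideanSpace ℝ (Fin n) =>
      heatKernel t (q.2 - q.1) * (1 + ‖q.2‖ ^ 2)) (ν.prod volume) := by
  refine integrable_prod_heatKernel_smul (F := ℝ) hν ht (by fun_prop) (C := 2) fun q => ?_
  rw [Real.norm_of_nonneg (by positivity)]
  have h : ‖q.2‖ ≤ ‖q.1‖ + ‖q.2 - q.1‖ := by simpa using norm_add_le q.1 (q.2 - q.1)
  nlinarith [mul_nonneg (sq_nonneg ‖q.1‖) (sq_nonneg ‖q.2 - q.1‖), norm_nonneg q.1,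
    norm_nonneg q.2, norm_nonneg (q.2 - q.1), sq_nonneg (‖q.1‖ - ‖q.2 - q.1‖)]

lemma integrable_heatDensity_mul_one_add (hν : Integrable (fun w => ‖w‖ ^ 2) ν) (ht : 0 < t) :
    Integrable (fun y => heatDensity ν t y * (1 + ‖y‖ ^ 2)) := by
  refine (integrable_prod_heatKernel_mul_one_add hν ht).integral_prod_right.congr
    (Filter.Eventually.of_forall fun y => ?_)
  simp only [integral_mul_const, heatDensity]

lemma integrable_prod_heatKernel_smul_snd {F : Type*} [NormedAddCommGroup F] [NormedSpace ℝ F]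
    (ht : 0 < t) {φ : EuclideanSpace ℝ (Fin n) → F} (hφ : AEStronglyMeasurable φ volume)
    (hi : Integrable fun y => heatDensity ν t y * ‖φ y‖) :
    Integrable (fun q => heatKernel t (q.2 - q.1) • φ q.2) (ν.prod volume) := by
  have hm : AEStronglyMeasurable (fun q => heatKernel t (q.2 - q.1) • φ q.2) (ν.prod volume) :=
    (continuous_heatKernel_snd_sub_fst t).aestronglyMeasurable.smul hφ.comp_snd
  rw [integrable_prod_iff' hm]
  refine ⟨Filter.Eventually.of_forall fun y =>
    (integrable_heatKernel_sub ht y).smul_const (φ y), hi.congr (Filter.Eventually.of_forall fun y => ?_)⟩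
  simp_rw [norm_smul, Real.norm_of_nonneg (heatKernel_pos ht _).le, integral_mul_const]
  rfl

lemma integral_prod_heatKernel_mul_norm_sq (hν : Integrable (fun w => ‖w‖ ^ 2) ν) (ht : 0 < t) :
    ∫ y, ∫ w, heatKernel t (y - w) * ‖y - w‖ ^ 2 ∂ν = n * t := by
  rw [← integral_integral_swap (f := fun w y => heatKernel t (y - w) * ‖y - w‖ ^ 2)
    (integrable_prod_heatKernel_mul_norm_sq hν ht)]
  have (w : EuclideanSpace ℝ (Fin n)) : ∫ y, heatKernel t (y - w) * ‖y - w‖ ^ 2 = n * t := by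
    rw [integral_sub_right_eq_self (fun y => heatKernel t y * ‖y‖ ^ 2) w,
      integral_heatKernel_mul_norm_sq ht]
  simp [this]

/-- Dropping the posterior variance from the pointwise decomposition leaves `t² p ‖s‖²` below the
conditional noise energy, which is integrable. -/
lemma integrable_heatDensity_mul_heatScore (hν : Integrable (fun w => ‖w‖ ^ 2) ν) (ht : 0 < t) :
    Integrable fun y => heatDensity ν t y * ‖heatScore ν t y‖ ^ 2 := by
  have h1 := (integrable_prod_heatKernel_mul_norm_sq hν ht).integral_prod_right
  have hc1 := continuous_heatDensity (ν := ν) ht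
  have hc2 := continuous_heatScore (ν := ν) ht
  refine (h1.const_mul (t ^ 2)⁻¹).mono' (by fun_prop) (Filter.Eventually.of_forall fun y => ?_)
  have hp := heatDensity_pos (ν := ν) ht y
  rw [Real.norm_of_nonneg (by positivity), ← div_eq_inv_mul, le_div_iff₀ (by positivity), mul_comm]
  simp only
  rw [integral_heatKernel_mul_norm_sq_eq_add_heatScore ht y]
  exact le_add_of_nonneg_left (integral_nonneg fun w =>
    mul_nonneg (heatKernel_pos ht _).le (by positivity))

lemma integrable_prod_heatKernel_mul_heatScore (hν : Integrable (fun w => ‖w‖ ^ 2) ν)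
    (ht : 0 < t) :
    Integrable (fun q : EuclideanSpace ℝ (Fin n) × EuclideanSpace ℝ (Fin n) =>
      heatKernel t (q.2 - q.1) * ‖heatScore ν t q.2‖ ^ 2) (ν.prod volume) := by
  have hc2 := continuous_heatScore (ν := ν) ht
  refine integrable_prod_heatKernel_smul_snd (F := ℝ) ht
    (φ := fun y => ‖heatScore ν t y‖ ^ 2) (by fun_prop) ?_
  simpa using integrable_heatDensity_mul_heatScore hν ht

lemma integrable_prod_heatKernel_mul_posterior (hν : Integrable (fun w => ‖w‖ ^ 2) ν)
    (ht : 0 < t) :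
    Integrable (fun q : EuclideanSpace ℝ (Fin n) × EuclideanSpace ℝ (Fin n) =>
      heatKernel t (q.2 - q.1) * ‖q.1 - posteriorMean ν t q.2‖ ^ 2) (ν.prod volume) := by
  have hc := continuous_posteriorMean (ν := ν) ht
  have hk := continuous_heatKernel_snd_sub_fst (n := n) t
  refine (((integrable_prod_heatKernel_mul_norm_sq hν ht).const_mul 2).add
    ((integrable_prod_heatKernel_mul_heatScore hν ht).const_mul (2 * t ^ 2))).mono'
    (Continuous.aestronglyMeasurable (by fun_prop)) (Filter.Eventually.of_forall fun q => ?_)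
  have hp := heatKernel_pos ht (q.2 - q.1)
  rw [Real.norm_of_nonneg (by positivity)]
  -- The estimation error is minus the noise minus `t` times the score, and both are square
  -- integrable.
  have e : q.1 - posteriorMean ν t q.2 = -((q.2 - q.1) + t • heatScore ν t q.2) := by
    rw [posteriorMean, heatScore, smul_smul, ← div_eq_mul_inv]; abel
  have h1 : ‖q.1 - posteriorMean ν t q.2‖ ≤ ‖q.2 - q.1‖ + t * ‖heatScore ν t q.2‖ := by
    rw [e, norm_neg]
    refine (norm_add_le _ _).trans_eq ?_
    rw [norm_smul, Real.norm_of_nonneg ht.le]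
  have h2 : ‖q.1 - posteriorMean ν t q.2‖ ^ 2 ≤
      2 * ‖q.2 - q.1‖ ^ 2 + 2 * t ^ 2 * ‖heatScore ν t q.2‖ ^ 2 := by
    nlinarith [sq_nonneg (‖q.2 - q.1‖ - t * ‖heatScore ν t q.2‖),
      norm_nonneg (q.1 - posteriorMean ν t q.2)]
  refine (mul_le_mul_of_nonneg_left h2 hp.le).trans_eq ?_
  simp only [Pi.add_apply]
  ring

/-- The noise energy splits into the posterior variance and the Fisher information. -/
lemma integral_posterior_variance (hν : Integrable (fun w => ‖w‖ ^ 2) ν) (ht : 0 < t) :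
    ∫ y, ∫ w, heatKernel t (y - w) * ‖w - posteriorMean ν t y‖ ^ 2 ∂ν =
      n * t - t ^ 2 * ∫ y, heatDensity ν t y * ‖heatScore ν t y‖ ^ 2 := by
  have h := integral_prod_heatKernel_mul_norm_sq hν ht
  simp_rw [integral_heatKernel_mul_norm_sq_eq_add_heatScore ht] at h
  rw [integral_add (integrable_prod_heatKernel_mul_posterior hν ht).integral_prod_right
    ((integrable_heatDensity_mul_heatScore hν ht).const_mul _), integral_const_mul] at h
  linarith

/-- For each `y` the posterior mean minimises the posterior quadratic error, so replacing it by a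
constant `c` only increases the integral; Fubini then integrates the noise out. -/
lemma integral_posterior_variance_le (hν : Integrable (fun w => ‖w‖ ^ 2) ν) (ht : 0 < t)
    (c : EuclideanSpace ℝ (Fin n)) :
    ∫ y, ∫ w, heatKernel t (y - w) * ‖w - posteriorMean ν t y‖ ^ 2 ∂ν ≤
      ∫ w, ‖w - c‖ ^ 2 ∂ν := by
  have hi : Integrable (fun q : EuclideanSpace ℝ (Fin n) × EuclideanSpace ℝ (Fin n) =>
      heatKernel t (q.2 - q.1) * ‖q.1 - c‖ ^ 2) (ν.prod volume) := by
    refine integrable_prod_heatKernel_smul (F := ℝ) hν ht (by fun_prop)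
      (C := 2 * (1 + ‖c‖ ^ 2)) fun q => ?_
    rw [Real.norm_of_nonneg (by positivity)]
    have h : ‖q.1 - c‖ ≤ ‖q.1‖ + ‖c‖ := norm_sub_le _ _
    have h2 : ‖q.1 - c‖ ^ 2 ≤ 2 * (1 + ‖c‖ ^ 2) * (1 + ‖q.1‖ ^ 2) := by
      nlinarith [sq_nonneg (‖q.1‖ - ‖c‖), norm_nonneg (q.1 - c),
        mul_nonneg (sq_nonneg ‖c‖) (sq_nonneg ‖q.1‖)]
    refine h2.trans ?_
    rw [← mul_assoc]
    exact le_mul_of_one_le_right (by positivity) (by nlinarith [sq_nonneg ‖q.2 - q.1‖])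
  have e : ∫ w, ‖w - c‖ ^ 2 ∂ν = ∫ y, ∫ w, heatKernel t (y - w) * ‖w - c‖ ^ 2 ∂ν := by
    rw [← integral_integral_swap (f := fun w y => heatKernel t (y - w) * ‖w - c‖ ^ 2) hi]
    refine integral_congr_ae (Filter.Eventually.of_forall fun w => ?_)
    simp only [integral_mul_const]
    rw [integral_sub_right_eq_self (fun y => heatKernel t y) w, integral_heatKernel ht, one_mul]
  rw [e]
  refine integral_mono (integrable_prod_heatKernel_mul_posterior hν ht).integral_prod_right
    hi.integral_prod_right fun y => ?_
  simp only
  rw [integral_heatKernel_mul_norm_sub_sq ht y c]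
  exact le_add_of_nonneg_right (mul_nonneg (heatDensity_pos ht y).le (by positivity))

lemma integrable_heatDensity_mul_log (hν : Integrable (fun w => ‖w‖ ^ 2) ν) (ht : 0 < t) :
    Integrable fun y => heatDensity ν t y * Real.log (heatDensity ν t y) := by
  obtain ⟨C, hC0, hC⟩ := exists_abs_log_heatDensity_le hν (b := t) ht
  have hc := continuous_heatDensity (ν := ν) ht
  refine ((integrable_heatDensity_mul_one_add hν ht).const_mul C).mono'
    (Continuous.aestronglyMeasurable (hc.mul (hc.log fun y => (heatDensity_pos ht y).ne')))
    (Filter.Eventually.of_forall fun y => ?_)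
  have hp := heatDensity_pos (ν := ν) ht y
  rw [norm_mul, Real.norm_of_nonneg hp.le, Real.norm_eq_abs]
  refine (mul_le_mul_of_nonneg_left (hC t ⟨le_rfl, le_rfl⟩ y) hp.le).trans_eq ?_
  ring

/-- Formally, `∂_t p = ½ Δp` followed by integration by parts against `log p + 1`. Green's identity
is applied to the kernel for each fixed `w` and then averaged over `w`, so no second derivative of
`p` is needed. -/
lemma integral_heatTimeDeriv_mul (hν : Integrable (fun w => ‖w‖ ^ 2) ν) (ht : 0 < t) :
    ∫ y, heatTimeDeriv ν t y * (Real.log (heatDensity ν t y) + 1) =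
      -(1 / 2) * ∫ y, heatDensity ν t y * ‖heatScore ν t y‖ ^ 2 := by
  obtain ⟨C, hC0, hC⟩ := exists_abs_log_heatDensity_le hν (b := t) ht
  have hcp := continuous_heatDensity (ν := ν) ht
  have hcs := continuous_heatScore (ν := ν) ht
  have hk := continuous_heatKernel_snd_sub_fst (n := n) t
  set u : EuclideanSpace ℝ (Fin n) → ℝ := fun y => Real.log (heatDensity ν t y) + 1 with hu
  have huc : Continuous u := (hcp.log fun y => (heatDensity_pos ht y).ne').add continuous_const
  have hub : ∀ y, |u y| ≤ (C + 1) * (1 + ‖y‖ ^ 2) := fun y => by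
    refine (abs_add_le _ _).trans ?_
    rw [abs_one]
    linarith [hC t ⟨le_rfl, le_rfl⟩ y, sq_nonneg ‖y‖]
  have hug : ∀ y, HasGradientAt u (heatScore ν t y) y := fun y => by
    rw [hasGradientAt_iff_hasFDerivAt]
    exact (hasGradientAt_log_heatDensity ht y).hasFDerivAt.add_const 1
  -- The constant of `heatKernel_mul_le` with `a = b = t`. The remaining kernel at time `2t` absorbs
  -- the quadratic growth of `u`.
  set K : ℝ := (2 * Real.pi * t) ^ (-(n : ℝ) / 2) / (2 * Real.pi * (2 * t)) ^ (-(n : ℝ) / 2) *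
    (1 + 4 * t)
  have I1 : Integrable (fun q : EuclideanSpace ℝ (Fin n) × EuclideanSpace ℝ (Fin n) =>
      (1 + ‖q.2 - q.1‖ ^ 2) * heatKernel t (q.2 - q.1) * u q.2) (ν.prod volume) := by
    refine ((integrable_prod_heatKernel_mul_one_add hν
      (by positivity : 0 < 2 * t)).const_mul (K * (C + 1))).mono'
      (Continuous.aestronglyMeasurable (by fun_prop)) (Filter.Eventually.of_forall fun q => ?_)
    have hp := heatKernel_pos ht (q.2 - q.1)
    have hp2 := heatKernel_pos (by positivity : 0 < 2 * t) (q.2 - q.1)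
    rw [norm_mul, Real.norm_of_nonneg (by positivity), Real.norm_eq_abs]
    calc (1 + ‖q.2 - q.1‖ ^ 2) * heatKernel t (q.2 - q.1) * |u q.2|
        ≤ (K * heatKernel (2 * t) (q.2 - q.1)) * ((C + 1) * (1 + ‖q.2‖ ^ 2)) :=
          mul_le_mul (heatKernel_mul_le ht le_rfl le_rfl _) (hub _) (abs_nonneg _) (by positivity)
      _ = _ := by ring
  have I2 : Integrable (fun q : EuclideanSpace ℝ (Fin n) × EuclideanSpace ℝ (Fin n) =>
      heatKernel t (q.2 - q.1) * (‖q.2 - q.1‖ * ‖heatScore ν t q.2‖)) (ν.prod volume) := by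
    refine ((integrable_prod_heatKernel_mul_norm_sq hν ht).add
      (integrable_prod_heatKernel_mul_heatScore hν ht)).mono'
      (Continuous.aestronglyMeasurable (by fun_prop)) (Filter.Eventually.of_forall fun q => ?_)
    have hp := heatKernel_pos ht (q.2 - q.1)
    rw [Real.norm_of_nonneg (by positivity)]
    simp only [Pi.add_apply]
    rw [← mul_add]
    gcongr
    nlinarith [sq_nonneg (‖q.2 - q.1‖ - ‖heatScore ν t q.2‖), sq_nonneg ‖q.2 - q.1‖,
      sq_nonneg ‖heatScore ν t q.2‖]
  have I3 : Integrable (fun q : EuclideanSpace ℝ (Fin n) × EuclideanSpace ℝ (Fin n) =>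
      heatKernel t (q.2 - q.1) * inner ℝ (q.2 - q.1) (heatScore ν t q.2)) (ν.prod volume) := by
    refine I2.mono' (Continuous.aestronglyMeasurable (by fun_prop))
      (Filter.Eventually.of_forall fun q => ?_)
    have hp := heatKernel_pos ht (q.2 - q.1)
    rw [norm_mul, Real.norm_of_nonneg hp.le]
    gcongr
    exact norm_inner_le_norm _ _
  have I4 : Integrable (fun q : EuclideanSpace ℝ (Fin n) × EuclideanSpace ℝ (Fin n) =>
      heatKernel t (q.2 - q.1) * (n - ‖q.2 - q.1‖ ^ 2 / t) * u q.2) (ν.prod volume) := by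
    refine (I1.norm.const_mul (n + 1 / t)).mono'
      (Continuous.aestronglyMeasurable (by fun_prop)) (Filter.Eventually.of_forall fun q => ?_)
    have hp := heatKernel_pos ht (q.2 - q.1)
    rw [norm_mul, norm_mul, norm_mul, norm_mul, ← mul_assoc, ← mul_assoc,
      mul_comm ‖heatKernel t (q.2 - q.1)‖]
    refine mul_le_mul_of_nonneg_right (mul_le_mul_of_nonneg_right ?_ (norm_nonneg _))
      (norm_nonneg _)
    rw [Real.norm_of_nonneg (by positivity : 0 ≤ 1 + ‖q.2 - q.1‖ ^ 2), Real.norm_eq_abs]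
    have h1 : 0 ≤ ‖q.2 - q.1‖ ^ 2 / t := by positivity
    have h2 : (0 : ℝ) ≤ n := by positivity
    have h3 : 0 ≤ 1 / t := by positivity
    have h4 : (n + 1 / t) * (1 + ‖q.2 - q.1‖ ^ 2) =
      n + 1 / t + n * ‖q.2 - q.1‖ ^ 2 + ‖q.2 - q.1‖ ^ 2 / t := by ring
    have h5 : 0 ≤ n * ‖q.2 - q.1‖ ^ 2 := by positivity
    rw [h4, abs_le]
    constructor <;> linarith
  have s1 : ∀ y, heatTimeDeriv ν t y * u y = -(1 / (2 * t)) *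
      ∫ w, heatKernel t (y - w) * (n - ‖y - w‖ ^ 2 / t) * u y ∂ν := by
    intro y
    rw [heatTimeDeriv, ← integral_mul_const, ← integral_const_mul]
    refine integral_congr_ae (Filter.Eventually.of_forall fun w => ?_)
    field_simp
    ring
  have s2 : ∫ y, ∫ w, heatKernel t (y - w) * (n - ‖y - w‖ ^ 2 / t) * u y ∂ν =
      -∫ y, ∫ w, heatKernel t (y - w) * inner ℝ (y - w) (heatScore ν t y) ∂ν := by
    rw [← integral_integral_swap
      (f := fun w y => heatKernel t (y - w) * (n - ‖y - w‖ ^ 2 / t) * u y) I4,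
      ← integral_integral_swap
      (f := fun w y => heatKernel t (y - w) * inner ℝ (y - w) (heatScore ν t y)) I3,
      ← integral_neg]
    refine integral_congr_ae ?_
    -- Fubini supplies the hypotheses of Green's identity for almost every `w`, which suffices.
    filter_upwards [I1.prod_right_ae, I2.prod_right_ae] with w h1 h2
    exact integral_heatKernel_mul_eq ht w hug h1 hcs.measurable h2
  -- The score does not depend on `w`, so the inner integral is its product with the mean of `y -
  -- w`, which is `-t p s`.
  have s3 : ∀ y, ∫ w, heatKernel t (y - w) * inner ℝ (y - w) (heatScore ν t y) ∂ν =
      -t * (heatDensity ν t y * ‖heatScore ν t y‖ ^ 2) := by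
    intro y
    have hp := heatDensity_pos (ν := ν) ht y
    have h1 := integral_inner (𝕜 := ℝ) (integrable_heatKernel_sub_smul_id (ν := ν) ht y y)
      (heatScore ν t y)
    have h2 : ∫ w, heatKernel t (y - w) • (w - y) ∂ν = (t * heatDensity ν t y) • heatScore ν t y := by
      rw [heatScore, smul_smul, mul_assoc, mul_inv_cancel₀ hp.ne', mul_one, heatGradient_eq,
        smul_smul, mul_inv_cancel₀ ht.ne', one_smul]
    rw [h2, inner_smul_right, real_inner_self_eq_norm_sq] at h1
    rw [neg_mul, ← mul_assoc, ← h1, ← integral_neg]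
    refine integral_congr_ae (Filter.Eventually.of_forall fun w => ?_)
    simp only
    rw [inner_smul_right, real_inner_comm, ← neg_sub w y, inner_neg_right, mul_neg]
  change ∫ y, heatTimeDeriv ν t y * u y = _
  simp_rw [s1]
  rw [integral_const_mul, s2]
  simp_rw [s3]
  rw [integral_const_mul]
  field_simp

/-- **De Bruijn's identity.** -/
lemma hasDerivAt_integral_heatDensity_mul_log (hν : Integrable (fun w => ‖w‖ ^ 2) ν)
    (ht : 0 < t) :
    HasDerivAt (fun s => ∫ y, heatDensity ν s y * Real.log (heatDensity ν s y))
      (-(1 / 2) * ∫ y, heatDensity ν t y * ‖heatScore ν t y‖ ^ 2) t := by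
  rw [← integral_heatTimeDeriv_mul hν ht]
  obtain ⟨C, hC0, hC⟩ := exists_abs_log_heatDensity_le hν (a := t / 2) (b := 2 * t) (by positivity)
  obtain ⟨K, hK0, hK⟩ := exists_abs_heatTimeDeriv_le ν (a := t / 2) (b := 2 * t) (by positivity)
  have hpos : ∀ s ∈ Icc (t / 2) (2 * t), 0 < s := fun s hs => by linarith [hs.1]
  have hmem : Icc (t / 2) (2 * t) ∈ nhds t :=
    Icc_mem_nhds (by linarith : t / 2 < t) (by linarith : t < 2 * t)
  refine (hasDerivAt_integral_of_dominated_loc_of_deriv_le (μ := volume)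
    (F := fun s y => heatDensity ν s y * Real.log (heatDensity ν s y))
    (F' := fun s y => heatTimeDeriv ν s y * (Real.log (heatDensity ν s y) + 1))
    -- The time derivative contributes the density at time `4t`, the factor `log p + 1` the
    -- quadratic weight.
    (bound := fun y => K * (C + 1) * (heatDensity ν (2 * (2 * t)) y * (1 + ‖y‖ ^ 2)))
    hmem ?_ (integrable_heatDensity_mul_log hν ht) ?_ ?_
    ((integrable_heatDensity_mul_one_add hν (by positivity)).const_mul _) ?_).2
  · filter_upwards [hmem] with s hs
    exact (integrable_heatDensity_mul_log hν (hpos s hs)).aestronglyMeasurable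
  · refine AEStronglyMeasurable.mul ?_ ?_
    · have hk := continuous_heatKernel_snd_sub_fst (n := n) t
      have : Continuous (fun q : EuclideanSpace ℝ (Fin n) × EuclideanSpace ℝ (Fin n) =>
          heatKernel t (q.1 - q.2) * (‖q.1 - q.2‖ ^ 2 / (2 * t ^ 2) - n / (2 * t))) := by
        have := hk.comp continuous_swap
        simp only [Function.comp_def, Prod.snd_swap, Prod.fst_swap] at this
        fun_prop
      exact (this.stronglyMeasurable.integral_prod_right (ν := ν)).aestronglyMeasurable
    · have hc := continuous_heatDensity (ν := ν) ht
      exact ((hc.log fun y => (heatDensity_pos ht y).ne').add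
        continuous_const).aestronglyMeasurable
  · refine Filter.Eventually.of_forall fun y s hs => ?_
    rw [norm_mul, Real.norm_eq_abs, Real.norm_eq_abs]
    have h1 : |Real.log (heatDensity ν s y) + 1| ≤ (C + 1) * (1 + ‖y‖ ^ 2) := by
      refine (abs_add_le _ _).trans ?_
      rw [abs_one]
      linarith [hC s hs y, sq_nonneg ‖y‖]
    have hp := heatDensity_pos (ν := ν) (by positivity : 0 < 2 * (2 * t)) y
    calc |heatTimeDeriv ν s y| * |Real.log (heatDensity ν s y) + 1|
        ≤ (K * heatDensity ν (2 * (2 * t)) y) * ((C + 1) * (1 + ‖y‖ ^ 2)) :=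
          mul_le_mul (hK s hs y) h1 (abs_nonneg _) (by positivity)
      _ = _ := by ring
  · refine Filter.Eventually.of_forall fun y s hs => ?_
    have h1 := hasDerivAt_heatDensity (ν := ν) (hpos s hs) y
    have hp := heatDensity_pos (ν := ν) (hpos s hs) y
    refine (h1.mul (h1.log hp.ne')).congr_deriv ?_
    field_simp

end joint

/-! ### From random vectors to the explicit densities: laws, conditional mean, mmse. -/

lemma MeasureTheory.MemLp.integrable_norm_sq_map {Ω : Type*} [MeasurableSpace Ω] {μ : Measure Ω}
    {n : ℕ} {W : Ω → EuclideanSpace ℝ (Fin n)} (hL : MemLp W 2 μ) (hW : Measurable W) :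
    Integrable (fun w => ‖w‖ ^ 2) (μ.map W) := by
  rw [integrable_map_measure (by fun_prop) hW.aemeasurable]
  exact (memLp_two_iff_integrable_sq_norm hW.aestronglyMeasurable).1 hL

section law

variable {Ω α : Type*} [MeasurableSpace Ω] [MeasurableSpace α] {μ : Measure Ω}
  [IsProbabilityMeasure μ] {n : ℕ} {t : ℝ} {U : Ω → α} {f : α → EuclideanSpace ℝ (Fin n)}
  {W Z : Ω → EuclideanSpace ℝ (Fin n)}

/-- The pair is the image of independent `(U, Z)` under the shear `(u, z) ↦ (u, f u + z)`, and
Lebesgue measure is translation invariant. Keeping `U` and `f` separate serves both `I(X; Y)` and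
`I(W; Y)`. -/
lemma map_prodMk_comp_add_eq_withDensity (ht : 0 < t) (hU : Measurable U) (hf : Measurable f)
    (hZ : Measurable Z)
    (hlaw : μ.map Z = multivariateGaussian 0 (t • (1 : Matrix (Fin n) (Fin n) ℝ)))
    (hUZ : IndepFun U Z μ) :
    μ.map (fun ω => (U ω, (f ∘ U + Z) ω)) = ((μ.map U).prod volume).withDensity
      fun q => ENNReal.ofReal (heatKernel t (q.2 - f q.1)) := by
  have hk := (continuous_heatKernel (n := n) t).measurable
  have hprob : IsProbabilityMeasure (μ.map U) := Measure.isProbabilityMeasure_map hU.aemeasurable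
  have hsh : Measurable fun q : α × EuclideanSpace ℝ (Fin n) => (q.1, f q.1 + q.2) := by fun_prop
  have h1 : μ.map (fun ω => (U ω, (f ∘ U + Z) ω)) =
      ((μ.map U).prod (μ.map Z)).map fun q => (q.1, f q.1 + q.2) := by
    rw [← (indepFun_iff_map_prod_eq_prod_map_map hU.aemeasurable hZ.aemeasurable).1 hUZ,
      Measure.map_map hsh (by fun_prop)]
    rfl
  have hp := isProbabilityMeasure_heatKernel (n := n) ht
  rw [h1, hlaw, multivariateGaussian_smul_one_eq_withDensity ht]
  refine Measure.ext_of_lintegral _ fun F hF => ?_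
  rw [lintegral_map hF hsh, prod_withDensity_right (by fun_prop),
    lintegral_withDensity_eq_lintegral_mul _ (by fun_prop) (by fun_prop),
    lintegral_withDensity_eq_lintegral_mul _ (by fun_prop) hF,
    lintegral_prod _ (by fun_prop), lintegral_prod _ (by fun_prop)]
  refine lintegral_congr fun u => ?_
  conv_rhs => rw [← lintegral_add_left_eq_self _ (f u)]
  simp

lemma map_prodMk_add_eq_withDensity (ht : 0 < t) (hW : Measurable W) (hZ : Measurable Z)
    (hlaw : μ.map Z = multivariateGaussian 0 (t • (1 : Matrix (Fin n) (Fin n) ℝ)))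
    (hWZ : IndepFun W Z μ) :
    μ.map (fun ω => (W ω, (W + Z) ω)) = ((μ.map W).prod volume).withDensity
      fun q => ENNReal.ofReal (heatKernel t (q.2 - q.1)) :=
  map_prodMk_comp_add_eq_withDensity ht hW measurable_id hZ hlaw hWZ

lemma map_add_eq_withDensity (ht : 0 < t) (hW : Measurable W) (hZ : Measurable Z)
    (hlaw : μ.map Z = multivariateGaussian 0 (t • (1 : Matrix (Fin n) (Fin n) ℝ)))
    (hWZ : IndepFun W Z μ) :
    μ.map (W + Z) = volume.withDensity fun y => ENNReal.ofReal (heatDensity (μ.map W) t y) := by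
  have hk := (continuous_heatKernel (n := n) t).measurable
  have hprob : IsProbabilityMeasure (μ.map W) := Measure.isProbabilityMeasure_map hW.aemeasurable
  have h1 : μ.map (W + Z) = (μ.map (fun ω => (W ω, (W + Z) ω))).map Prod.snd := by
    rw [Measure.map_map (by fun_prop) (by fun_prop)]
    rfl
  have hd := (continuous_heatDensity (ν := μ.map W) ht).measurable
  rw [h1, map_prodMk_add_eq_withDensity ht hW hZ hlaw hWZ]
  refine Measure.ext_of_lintegral _ fun F hF => ?_
  rw [lintegral_map hF (by fun_prop),
    lintegral_withDensity_eq_lintegral_mul _ (by fun_prop) (by fun_prop),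
    lintegral_withDensity_eq_lintegral_mul _ (by fun_prop) hF,
    lintegral_prod_symm _ (by fun_prop)]
  refine lintegral_congr fun y => ?_
  simp only [Pi.mul_apply]
  rw [lintegral_mul_const _ (by fun_prop), heatDensity,
    ofReal_integral_eq_lintegral_ofReal (integrable_heatKernel_sub ht y)
      (Filter.Eventually.of_forall fun w => (heatKernel_pos ht _).le)]

lemma isC1Density_heatDensity (ht : 0 < t) (hW : Measurable W) (hZ : Measurable Z)
    (hlaw : μ.map Z = multivariateGaussian 0 (t • (1 : Matrix (Fin n) (Fin n) ℝ)))
    (hWZ : IndepFun W Z μ) : IsC1Density (μ.map (W + Z)) (heatDensity (μ.map W) t) :=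
  have : IsProbabilityMeasure (μ.map W) := Measure.isProbabilityMeasure_map hW.aemeasurable
  ⟨contDiff_heatDensity ht, fun y => (heatDensity_pos ht y).le,
    map_add_eq_withDensity ht hW hZ hlaw hWZ⟩

lemma IsC1Density.eq {ν : Measure (EuclideanSpace ℝ (Fin n))} {p q : EuclideanSpace ℝ (Fin n) → ℝ}
    (hp : IsC1Density ν p) (hq : IsC1Density ν q) : p = q := by
  have hpc := hp.contDiff.continuous
  have hqc := hq.contDiff.continuous
  have h := hp.eq_withDensity.symm.trans hq.eq_withDensity
  rw [withDensity_eq_iff_of_sigmaFinite (by fun_prop) (by fun_prop)] at h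
  rw [← hpc.ae_eq_iff_eq volume hqc]
  filter_upwards [h] with y hy
  exact (ENNReal.ofReal_eq_ofReal_iff (hp.nonneg y) (hq.nonneg y)).1 hy

lemma IsC1Density.density_eq {ν : Measure (EuclideanSpace ℝ (Fin n))}
    {p : EuclideanSpace ℝ (Fin n) → ℝ} (hp : IsC1Density ν p) : density ν = p := by
  have h : ∃ p, IsC1Density ν p := ⟨p, hp⟩
  rw [density, dif_pos h]
  exact h.choose_spec.eq hp

lemma density_map_add (ht : 0 < t) (hW : Measurable W) (hZ : Measurable Z)
    (hlaw : μ.map Z = multivariateGaussian 0 (t • (1 : Matrix (Fin n) (Fin n) ℝ)))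
    (hWZ : IndepFun W Z μ) : density (μ.map (W + Z)) = heatDensity (μ.map W) t :=
  (isC1Density_heatDensity ht hW hZ hlaw hWZ).density_eq

lemma score_map_add (ht : 0 < t) (hW : Measurable W) (hZ : Measurable Z)
    (hlaw : μ.map Z = multivariateGaussian 0 (t • (1 : Matrix (Fin n) (Fin n) ℝ)))
    (hWZ : IndepFun W Z μ) : score (μ.map (W + Z)) = heatScore (μ.map W) t := by
  have : IsProbabilityMeasure (μ.map W) := Measure.isProbabilityMeasure_map hW.aemeasurable
  ext1 y
  rw [score, density_map_add ht hW hZ hlaw hWZ]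
  exact (hasGradientAt_log_heatDensity ht y).gradient

lemma hasFiniteFisherInfo_add (ht : 0 < t) (hW : Measurable W) (hZ : Measurable Z)
    (hlaw : μ.map Z = multivariateGaussian 0 (t • (1 : Matrix (Fin n) (Fin n) ℝ)))
    (hWZ : IndepFun W Z μ) (hL : MemLp W 2 μ) : HasFiniteFisherInfo (W + Z) μ := by
  have : IsProbabilityMeasure (μ.map W) := Measure.isProbabilityMeasure_map hW.aemeasurable
  have hc := continuous_heatDensity (ν := μ.map W) ht
  rw [HasFiniteFisherInfo, density_map_add ht hW hZ hlaw hWZ, score_map_add ht hW hZ hlaw hWZ]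
  refine ⟨isC1Density_heatDensity ht hW hZ hlaw hWZ, heatDensity_pos ht, ?_⟩
  rw [map_add_eq_withDensity ht hW hZ hlaw hWZ,
    integrable_withDensity_iff_integrable_smul' (by fun_prop) (by simp)]
  refine (integrable_heatDensity_mul_heatScore (hL.integrable_norm_sq_map hW) ht).congr
    (Filter.Eventually.of_forall fun y => ?_)
  simp [ENNReal.toReal_ofReal (heatDensity_pos ht y).le]

lemma fisherInfo_add (ht : 0 < t) (hW : Measurable W) (hZ : Measurable Z)
    (hlaw : μ.map Z = multivariateGaussian 0 (t • (1 : Matrix (Fin n) (Fin n) ℝ)))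
    (hWZ : IndepFun W Z μ) : fisherInfo (W + Z) μ =
      ∫ y, heatDensity (μ.map W) t y * ‖heatScore (μ.map W) t y‖ ^ 2 := by
  have : IsProbabilityMeasure (μ.map W) := Measure.isProbabilityMeasure_map hW.aemeasurable
  have hc := continuous_heatDensity (ν := μ.map W) ht
  rw [fisherInfo, score_map_add ht hW hZ hlaw hWZ, map_add_eq_withDensity ht hW hZ hlaw hWZ,
    integral_withDensity_eq_integral_toReal_smul (by fun_prop) (by simp)]
  refine integral_congr_ae (Filter.Eventually.of_forall fun y => ?_)
  simp [ENNReal.toReal_ofReal (heatDensity_pos ht y).le]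

lemma integrable_comp_channel_iff {F : Type*} [NormedAddCommGroup F] [NormedSpace ℝ F] (ht : 0 < t)
    (hW : Measurable W) (hZ : Measurable Z)
    (hlaw : μ.map Z = multivariateGaussian 0 (t • (1 : Matrix (Fin n) (Fin n) ℝ)))
    (hWZ : IndepFun W Z μ) {Φ : EuclideanSpace ℝ (Fin n) × EuclideanSpace ℝ (Fin n) → F}
    (hΦ : StronglyMeasurable Φ) :
    Integrable (fun ω => Φ (W ω, (W + Z) ω)) μ ↔
      Integrable (fun q => heatKernel t (q.2 - q.1) • Φ q) ((μ.map W).prod volume) := by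
  have hk := (continuous_heatKernel_snd_sub_fst (n := n) t).measurable
  rw [← Function.comp_def Φ (fun ω => (W ω, (W + Z) ω)),
    ← integrable_map_measure hΦ.aestronglyMeasurable (by fun_prop),
    map_prodMk_add_eq_withDensity ht hW hZ hlaw hWZ,
    integrable_withDensity_iff_integrable_smul' (by fun_prop) (by simp)]
  simp_rw [ENNReal.toReal_ofReal (heatKernel_pos ht _).le]

lemma integral_comp_channel {F : Type*} [NormedAddCommGroup F] [NormedSpace ℝ F] (ht : 0 < t)
    (hW : Measurable W) (hZ : Measurable Z)
    (hlaw : μ.map Z = multivariateGaussian 0 (t • (1 : Matrix (Fin n) (Fin n) ℝ)))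
    (hWZ : IndepFun W Z μ) {Φ : EuclideanSpace ℝ (Fin n) × EuclideanSpace ℝ (Fin n) → F}
    (hΦ : StronglyMeasurable Φ)
    (hi : Integrable (fun q => heatKernel t (q.2 - q.1) • Φ q) ((μ.map W).prod volume)) :
    ∫ ω, Φ (W ω, (W + Z) ω) ∂μ = ∫ y, ∫ w, heatKernel t (y - w) • Φ (w, y) ∂(μ.map W) := by
  have hk := (continuous_heatKernel_snd_sub_fst (n := n) t).measurable
  rw [← integral_map (φ := fun ω => (W ω, (W + Z) ω)) (by fun_prop) hΦ.aestronglyMeasurable,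
    map_prodMk_add_eq_withDensity ht hW hZ hlaw hWZ,
    integral_withDensity_eq_integral_toReal_smul (by fun_prop) (by simp)]
  simp_rw [ENNReal.toReal_ofReal (heatKernel_pos ht _).le]
  exact integral_prod_symm _ hi

lemma integrable_norm_sub_posteriorMean (ht : 0 < t) (hW : Measurable W) (hZ : Measurable Z)
    (hlaw : μ.map Z = multivariateGaussian 0 (t • (1 : Matrix (Fin n) (Fin n) ℝ)))
    (hWZ : IndepFun W Z μ) (hL : MemLp W 2 μ) :
    Integrable (fun ω => ‖W ω - posteriorMean (μ.map W) t ((W + Z) ω)‖ ^ 2) μ := by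
  have : IsProbabilityMeasure (μ.map W) := Measure.isProbabilityMeasure_map hW.aemeasurable
  have hc := continuous_posteriorMean (ν := μ.map W) ht
  exact (integrable_comp_channel_iff ht hW hZ hlaw hWZ
    (Φ := fun q => ‖q.1 - posteriorMean (μ.map W) t q.2‖ ^ 2)
    (Continuous.stronglyMeasurable (by fun_prop))).2
    (integrable_prod_heatKernel_mul_posterior (hL.integrable_norm_sq_map hW) ht)

/-- Over an event `Y ∈ A`, Fubini turns the integral of `W - m(Y)` into an integral over `A` of
posterior means of `w - m(y)`, weighted by the density; these vanish by Tweedie's formula. -/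
lemma condExp_eq_posteriorMean (ht : 0 < t) (hW : Measurable W) (hZ : Measurable Z)
    (hlaw : μ.map Z = multivariateGaussian 0 (t • (1 : Matrix (Fin n) (Fin n) ℝ)))
    (hWZ : IndepFun W Z μ) (hL : MemLp W 2 μ) :
    μ[W | MeasurableSpace.comap (W + Z) inferInstance] =ᵐ[μ]
      fun ω => posteriorMean (μ.map W) t ((W + Z) ω) := by
  have : IsProbabilityMeasure (μ.map W) := Measure.isProbabilityMeasure_map hW.aemeasurable
  have hY : Measurable (W + Z) := hW.add hZ
  have hc := continuous_posteriorMean (ν := μ.map W) ht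
  have hWi : Integrable W μ := hL.integrable one_le_two
  have hdi : Integrable (fun ω => W ω - posteriorMean (μ.map W) t ((W + Z) ω)) μ :=
    MemLp.integrable one_le_two ((memLp_two_iff_integrable_sq_norm
      (hW.sub (hc.measurable.comp hY)).aestronglyMeasurable).2
      (integrable_norm_sub_posteriorMean ht hW hZ hlaw hWZ hL))
  have hmi : Integrable (fun ω => posteriorMean (μ.map W) t ((W + Z) ω)) μ := by
    refine (hWi.sub hdi).congr (Filter.Eventually.of_forall fun ω => ?_)
    simp
  refine (ae_eq_condExp_of_forall_setIntegral_eq hY.comap_le hWi (fun s _ _ => hmi.integrableOn)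
    ?_ ?_).symm
  · rintro s ⟨A, hA, rfl⟩ -
    rw [eq_comm, ← sub_eq_zero, ← integral_sub hWi.integrableOn hmi.integrableOn,
      ← integral_indicator (hY hA)]
    have hΦ : StronglyMeasurable fun q : EuclideanSpace ℝ (Fin n) × EuclideanSpace ℝ (Fin n) =>
        (Prod.snd ⁻¹' A).indicator (fun q => q.1 - posteriorMean (μ.map W) t q.2) q :=
      (Continuous.stronglyMeasurable (by fun_prop)).indicator (measurable_snd hA)
    have e : ((W + Z) ⁻¹' A).indicator (fun ω => W ω - posteriorMean (μ.map W) t ((W + Z) ω)) =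
        fun ω => (Prod.snd ⁻¹' A).indicator
          (fun q => q.1 - posteriorMean (μ.map W) t q.2) (W ω, (W + Z) ω) := by
      ext1 ω
      rfl
    rw [e, integral_comp_channel ht hW hZ hlaw hWZ hΦ
      ((integrable_comp_channel_iff ht hW hZ hlaw hWZ hΦ).1 (e ▸ hdi.indicator (hY hA)))]
    refine integral_eq_zero_of_ae (Filter.Eventually.of_forall fun y => ?_)
    by_cases hy : y ∈ A
    · simpa [indicator, hy] using integral_heatKernel_smul_sub_posteriorMean (ν := μ.map W) ht y
    · simp [indicator, hy]
  · exact (hc.stronglyMeasurable.comp_measurable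
      (comap_measurable (W + Z))).aestronglyMeasurable

lemma mmse_add (ht : 0 < t) (hW : Measurable W) (hZ : Measurable Z)
    (hlaw : μ.map Z = multivariateGaussian 0 (t • (1 : Matrix (Fin n) (Fin n) ℝ)))
    (hWZ : IndepFun W Z μ) (hL : MemLp W 2 μ) : mmse W (W + Z) μ =
      ∫ y, ∫ w, heatKernel t (y - w) * ‖w - posteriorMean (μ.map W) t y‖ ^ 2 ∂(μ.map W) := by
  have : IsProbabilityMeasure (μ.map W) := Measure.isProbabilityMeasure_map hW.aemeasurable
  have hc := continuous_posteriorMean (ν := μ.map W) ht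
  have h := integral_comp_channel ht hW hZ hlaw hWZ
    (Φ := fun q => ‖q.1 - posteriorMean (μ.map W) t q.2‖ ^ 2)
    (Continuous.stronglyMeasurable (by fun_prop))
    (integrable_prod_heatKernel_mul_posterior (hL.integrable_norm_sq_map hW) ht)
  simp only [smul_eq_mul] at h
  rw [← h, mmse]
  refine integral_congr_ae ?_
  filter_upwards [condExp_eq_posteriorMean ht hW hZ hlaw hWZ hL] with ω hω
  rw [hω]

lemma div_sub_fisherInfo_eq_mmse (ht : 0 < t) (hW : Measurable W) (hZ : Measurable Z)
    (hlaw : μ.map Z = multivariateGaussian 0 (t • (1 : Matrix (Fin n) (Fin n) ℝ)))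
    (hWZ : IndepFun W Z μ) (hL : MemLp W 2 μ) :
    n / t - fisherInfo (W + Z) μ = mmse W (W + Z) μ / t ^ 2 := by
  have : IsProbabilityMeasure (μ.map W) := Measure.isProbabilityMeasure_map hW.aemeasurable
  rw [mmse_add ht hW hZ hlaw hWZ hL, fisherInfo_add ht hW hZ hlaw hWZ,
    integral_posterior_variance (hL.integrable_norm_sq_map hW) ht]
  field_simp

lemma trace_covMat (hW : Measurable W) (hL : MemLp W 2 μ) :
    ∃ c : EuclideanSpace ℝ (Fin n), (covMat W μ).trace = ∫ w, ‖w - c‖ ^ 2 ∂(μ.map W) := by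
  -- The centre is the mean of `W`, coordinate by coordinate.
  refine ⟨WithLp.toLp 2 fun i => ∫ ω, W ω i ∂μ, ?_⟩
  rw [integral_map hW.aemeasurable (by fun_prop)]
  simp_rw [EuclideanSpace.real_norm_sq_eq]
  have hi : ∀ i, Integrable (fun ω => (W ω i - ∫ ω, W ω i ∂μ) ^ 2) μ := fun i => by
    have h1 : MemLp (fun ω => W ω i) 2 μ := by
      refine hL.mono (by fun_prop) (Filter.Eventually.of_forall fun ω => PiLp.norm_apply_le _ _)
    exact (h1.sub (memLp_const _)).integrable_sq
  simp only [PiLp.sub_apply]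
  rw [integral_finsetSum _ fun i _ => hi i]
  simp [Matrix.trace, covMat, covariance, sq]

lemma mmse_le_trace_covMat (ht : 0 < t) (hW : Measurable W) (hZ : Measurable Z)
    (hlaw : μ.map Z = multivariateGaussian 0 (t • (1 : Matrix (Fin n) (Fin n) ℝ)))
    (hWZ : IndepFun W Z μ) (hL : MemLp W 2 μ) :
    mmse W (W + Z) μ ≤ (covMat W μ).trace := by
  have : IsProbabilityMeasure (μ.map W) := Measure.isProbabilityMeasure_map hW.aemeasurable
  obtain ⟨c, hc⟩ := trace_covMat hW hL
  rw [hc, mmse_add ht hW hZ hlaw hWZ hL]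
  exact integral_posterior_variance_le (hL.integrable_norm_sq_map hW) ht c

end law

/-! ### Mutual information: invariance under `f`, entropy formula, decay. -/

section mutualInfo

variable {Ω α : Type*} [MeasurableSpace Ω] [MeasurableSpace α] {μ : Measure Ω}
  [IsProbabilityMeasure μ] {n : ℕ} {t : ℝ} {U : Ω → α} {f : α → EuclideanSpace ℝ (Fin n)}
  {W Z : Ω → EuclideanSpace ℝ (Fin n)}

/-- The joint law of input and output has the likelihood ratio as its density with respect to the
product of the marginals. -/
lemma map_prodMk_eq_prod_withDensity (ht : 0 < t) (hU : Measurable U) (hf : Measurable f)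
    (hZ : Measurable Z)
    (hlaw : μ.map Z = multivariateGaussian 0 (t • (1 : Matrix (Fin n) (Fin n) ℝ)))
    (hUZ : IndepFun U Z μ) :
    μ.map (fun ω => (U ω, (f ∘ U + Z) ω)) = ((μ.map U).prod (μ.map (f ∘ U + Z))).withDensity
      fun q => ENNReal.ofReal (heatKernel t (q.2 - f q.1) / heatDensity (μ.map (f ∘ U)) t q.2) := by
  have hk := (continuous_heatKernel (n := n) t).measurable
  have hW : Measurable (f ∘ U) := hf.comp hU
  have : IsProbabilityMeasure (μ.map (f ∘ U)) := Measure.isProbabilityMeasure_map hW.aemeasurable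
  have hd := (continuous_heatDensity (ν := μ.map (f ∘ U)) ht).measurable
  have hWZ : IndepFun (f ∘ U) Z μ := hUZ.comp hf measurable_id
  rw [map_prodMk_comp_add_eq_withDensity ht hU hf hZ hlaw hUZ,
    map_add_eq_withDensity ht hW hZ hlaw hWZ, prod_withDensity_right (by fun_prop),
    ← withDensity_mul _ (by fun_prop) (by fun_prop)]
  congr 1
  ext1 q
  have hp := heatDensity_pos (ν := μ.map (f ∘ U)) ht q.2
  rw [Pi.mul_apply, ← ENNReal.ofReal_mul hp.le, mul_div_cancel₀ _ hp.ne']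

/-- Since `klFun` is nonnegative, this form is valid in `[0, ∞]` even when the divergence is
infinite, so it can be compared across inputs without moments. -/
lemma mutualInfo_eq_lintegral (ht : 0 < t) (hU : Measurable U) (hf : Measurable f)
    (hZ : Measurable Z)
    (hlaw : μ.map Z = multivariateGaussian 0 (t • (1 : Matrix (Fin n) (Fin n) ℝ)))
    (hUZ : IndepFun U Z μ) :
    mutualInfo U (f ∘ U + Z) μ = ∫⁻ q, ENNReal.ofReal (klFun
      (heatKernel t (q.2 - f q.1) / heatDensity (μ.map (f ∘ U)) t q.2))
      ∂((μ.map U).prod (μ.map (f ∘ U + Z))) := by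
  have hk := (continuous_heatKernel (n := n) t).measurable
  have hW : Measurable (f ∘ U) := hf.comp hU
  have : IsProbabilityMeasure (μ.map (f ∘ U)) := Measure.isProbabilityMeasure_map hW.aemeasurable
  have : IsProbabilityMeasure (μ.map U) := Measure.isProbabilityMeasure_map hU.aemeasurable
  have : IsProbabilityMeasure (μ.map (f ∘ U + Z)) :=
    Measure.isProbabilityMeasure_map (hW.add hZ).aemeasurable
  have : IsProbabilityMeasure (μ.map fun ω => (U ω, (f ∘ U + Z) ω)) :=
    Measure.isProbabilityMeasure_map (hU.prodMk (hW.add hZ)).aemeasurable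
  have hd := (continuous_heatDensity (ν := μ.map (f ∘ U)) ht).measurable
  have h := map_prodMk_eq_prod_withDensity ht hU hf hZ hlaw hUZ
  rw [mutualInfo, klDiv_eq_lintegral_klFun_of_ac (h ▸ withDensity_absolutelyContinuous _ _)]
  refine lintegral_congr_ae ?_
  rw [h]
  filter_upwards [Measure.rnDeriv_withDensity ((μ.map U).prod (μ.map (f ∘ U + Z)))
    (f := fun q => ENNReal.ofReal
      (heatKernel t (q.2 - f q.1) / heatDensity (μ.map (f ∘ U)) t q.2)) (by fun_prop)] with q hq
  rw [hq, ENNReal.toReal_ofReal (div_nonneg (heatKernel_pos ht _).le (heatDensity_pos ht _).le)]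

/-- The likelihood ratio sees `u` only through `f u`, so the two integrals differ by the change of
variables `(u, y) ↦ (f u, y)`. -/
lemma mutualInfo_comp_eq (ht : 0 < t) (hU : Measurable U) (hf : Measurable f) (hZ : Measurable Z)
    (hlaw : μ.map Z = multivariateGaussian 0 (t • (1 : Matrix (Fin n) (Fin n) ℝ)))
    (hUZ : IndepFun U Z μ) :
    mutualInfo U (f ∘ U + Z) μ = mutualInfo (f ∘ U) (f ∘ U + Z) μ := by
  have hk := (continuous_heatKernel (n := n) t).measurable
  have hW : Measurable (f ∘ U) := hf.comp hU
  have hWZ : IndepFun (f ∘ U) Z μ := hUZ.comp hf measurable_id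
  have : IsProbabilityMeasure (μ.map (f ∘ U)) := Measure.isProbabilityMeasure_map hW.aemeasurable
  have : IsProbabilityMeasure (μ.map U) := Measure.isProbabilityMeasure_map hU.aemeasurable
  have : IsProbabilityMeasure (μ.map (f ∘ U + Z)) :=
    Measure.isProbabilityMeasure_map (hW.add hZ).aemeasurable
  have hd := (continuous_heatDensity (ν := μ.map (f ∘ U)) ht).measurable
  have h2 := mutualInfo_eq_lintegral ht hW measurable_id hZ hlaw hWZ
  simp only [Function.id_comp, id] at h2
  have hQ : (μ.map (f ∘ U)).prod (μ.map (f ∘ U + Z)) =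
      ((μ.map U).prod (μ.map (f ∘ U + Z))).map (Prod.map f id) := by
    rw [← Measure.map_prod_map _ _ hf measurable_id, Measure.map_id, Measure.map_map hf hU]
  have hm := measurable_klFun
  rw [h2, mutualInfo_eq_lintegral ht hU hf hZ hlaw hUZ, hQ,
    lintegral_map (by fun_prop) (by fun_prop)]
  rfl

/-- The log-likelihood ratio is `log g_t(y - w) - log p_t(y)`, with `g_t` the kernel. Its first part
has mean minus the noise entropy, the term `n / 2` being `𝔼 ‖Z‖² / (2t)`. The second moment makes
each part integrable separately. -/
lemma mutualInfo_add_ne_top_and_toReal (ht : 0 < t) (hW : Measurable W) (hZ : Measurable Z)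
    (hlaw : μ.map Z = multivariateGaussian 0 (t • (1 : Matrix (Fin n) (Fin n) ℝ)))
    (hWZ : IndepFun W Z μ) (hL : MemLp W 2 μ) :
    mutualInfo W (W + Z) μ ≠ ⊤ ∧ (mutualInfo W (W + Z) μ).toReal =
      -(n : ℝ) / 2 * Real.log (2 * Real.pi * t) - n / 2 -
        ∫ y, heatDensity (μ.map W) t y * Real.log (heatDensity (μ.map W) t y) := by
  have hk := continuous_heatKernel_snd_sub_fst (n := n) t
  have hν := hL.integrable_norm_sq_map hW
  set ν := μ.map W with hνdef
  have : IsProbabilityMeasure ν := Measure.isProbabilityMeasure_map hW.aemeasurable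
  have : IsProbabilityMeasure (μ.map (W + Z)) :=
    Measure.isProbabilityMeasure_map (hW.add hZ).aemeasurable
  have : IsProbabilityMeasure (μ.map fun ω => (W ω, (W + Z) ω)) :=
    Measure.isProbabilityMeasure_map (hW.prodMk (hW.add hZ)).aemeasurable
  have hc := continuous_heatDensity (ν := ν) ht
  have hcl : Continuous fun y => Real.log (heatDensity ν t y) :=
    hc.log fun y => (heatDensity_pos ht y).ne'
  have h := map_prodMk_eq_prod_withDensity ht hW measurable_id hZ hlaw hWZ
  simp only [Function.id_comp, id, ← hνdef] at h
  have hac : μ.map (fun ω => (W ω, (W + Z) ω)) ≪ ν.prod (μ.map (W + Z)) :=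
    h ▸ withDensity_absolutelyContinuous _ _
  set Φ : EuclideanSpace ℝ (Fin n) × EuclideanSpace ℝ (Fin n) → ℝ := fun q =>
    -(n : ℝ) / 2 * Real.log (2 * Real.pi * t) - ‖q.2 - q.1‖ ^ 2 / (2 * t) -
      Real.log (heatDensity ν t q.2) with hΦ
  have hΦc : Continuous Φ := (Continuous.sub (by fun_prop) (by fun_prop)).sub
    (hcl.comp continuous_snd)
  have hllr : llr (μ.map fun ω => (W ω, (W + Z) ω)) (ν.prod (μ.map (W + Z))) =ᵐ[
      μ.map fun ω => (W ω, (W + Z) ω)] Φ := by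
    refine hac.ae_le ?_
    rw [h]
    filter_upwards [Measure.rnDeriv_withDensity (ν.prod (μ.map (W + Z)))
      (f := fun q => ENNReal.ofReal (heatKernel t (q.2 - q.1) / heatDensity ν t q.2))
      (by fun_prop)] with q hq
    have h1 := heatKernel_pos ht (q.2 - q.1)
    have h2 := heatDensity_pos (ν := ν) ht q.2
    rw [llr_def]
    simp only
    rw [hq, ENNReal.toReal_ofReal (by positivity), Real.log_div h1.ne' h2.ne',
      log_heatKernel ht]
  have J0 : Integrable (fun q : EuclideanSpace ℝ (Fin n) × EuclideanSpace ℝ (Fin n) =>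
      heatKernel t (q.2 - q.1) * (-(n : ℝ) / 2 * Real.log (2 * Real.pi * t))) (ν.prod volume) :=
    integrable_prod_heatKernel_smul (F := ℝ) hν ht (by fun_prop)
      (C := |-(n : ℝ) / 2 * Real.log (2 * Real.pi * t)|) fun q => by
        rw [Real.norm_eq_abs]
        refine le_mul_of_one_le_right (abs_nonneg _) ?_
        nlinarith [mul_nonneg (sq_nonneg ‖q.1‖) (sq_nonneg ‖q.2 - q.1‖), sq_nonneg ‖q.1‖,
          sq_nonneg ‖q.2 - q.1‖]
  have J1 := (integrable_prod_heatKernel_mul_norm_sq hν ht).div_const (2 * t)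
  have J2 : Integrable (fun q : EuclideanSpace ℝ (Fin n) × EuclideanSpace ℝ (Fin n) =>
      heatKernel t (q.2 - q.1) * Real.log (heatDensity ν t q.2)) (ν.prod volume) := by
    refine integrable_prod_heatKernel_smul_snd (F := ℝ) ht hcl.aestronglyMeasurable ?_
    refine (integrable_heatDensity_mul_log hν ht).norm.congr
      (Filter.Eventually.of_forall fun y => ?_)
    simp only
    rw [norm_mul, Real.norm_of_nonneg (heatDensity_pos ht y).le]
  have e : ∀ q : EuclideanSpace ℝ (Fin n) × EuclideanSpace ℝ (Fin n),
      heatKernel t (q.2 - q.1) • Φ q =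
        heatKernel t (q.2 - q.1) * (-(n : ℝ) / 2 * Real.log (2 * Real.pi * t)) -
        heatKernel t (q.2 - q.1) * ‖q.2 - q.1‖ ^ 2 / (2 * t) -
        heatKernel t (q.2 - q.1) * Real.log (heatDensity ν t q.2) := fun q => by
    simp only [hΦ, smul_eq_mul]
    ring
  have hi : Integrable (fun q => heatKernel t (q.2 - q.1) • Φ q) (ν.prod volume) := by
    simp_rw [e]
    exact (J0.sub J1).sub J2
  have hiμ := (integrable_comp_channel_iff ht hW hZ hlaw hWZ hΦc.stronglyMeasurable).2 hi
  have hmeas : AEMeasurable (fun ω => (W ω, (W + Z) ω)) μ :=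
    (hW.prodMk (hW.add hZ)).aemeasurable
  have hiP : Integrable Φ (μ.map fun ω => (W ω, (W + Z) ω)) := by
    rw [integrable_map_measure hΦc.aestronglyMeasurable hmeas]
    exact hiμ
  refine ⟨klDiv_ne_top hac (hiP.congr hllr.symm), ?_⟩
  -- Both measures have mass one, so the divergence is the plain integral of the log-likelihood
  -- ratio.
  rw [mutualInfo, toReal_klDiv_of_measure_eq hac (by simp), integral_congr_ae hllr,
    integral_map hmeas hΦc.aestronglyMeasurable,
    integral_comp_channel ht hW hZ hlaw hWZ hΦc.stronglyMeasurable hi,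
    ← integral_prod_symm _ hi]
  simp_rw [e]
  have J01 : Integrable (fun q : EuclideanSpace ℝ (Fin n) × EuclideanSpace ℝ (Fin n) =>
      heatKernel t (q.2 - q.1) * (-(n : ℝ) / 2 * Real.log (2 * Real.pi * t)) -
        heatKernel t (q.2 - q.1) * ‖q.2 - q.1‖ ^ 2 / (2 * t)) (ν.prod volume) := J0.sub J1
  rw [integral_sub J01 J2, integral_sub J0 J1, integral_div, integral_prod _ J0, integral_prod_symm _ (integrable_prod_heatKernel_mul_norm_sq hν ht),
    integral_prod_symm _ J2]
  simp only
  rw [integral_prod_heatKernel_mul_norm_sq hν ht]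
  have s0 (w : EuclideanSpace ℝ (Fin n)) : ∫ y, heatKernel t (y - w) = 1 := by
    rw [integral_sub_right_eq_self (fun y => heatKernel t y) w, integral_heatKernel ht]
  simp_rw [integral_mul_const, s0]
  simp only [one_mul, integral_const, probReal_univ, one_smul, heatDensity]
  field_simp

lemma integral_heatDensity_mul_norm_sub_sq {ν : Measure (EuclideanSpace ℝ (Fin n))}
    [IsProbabilityMeasure ν] (hν : Integrable (fun w => ‖w‖ ^ 2) ν) (ht : 0 < t)
    (a : EuclideanSpace ℝ (Fin n)) :
    Integrable (fun y => heatDensity ν t y * ‖y - a‖ ^ 2) ∧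
      ∫ y, heatDensity ν t y * ‖y - a‖ ^ 2 = n * t + ∫ w, ‖w - a‖ ^ 2 ∂ν := by
  have hi : Integrable (fun q : EuclideanSpace ℝ (Fin n) × EuclideanSpace ℝ (Fin n) =>
      heatKernel t (q.2 - q.1) * ‖q.2 - a‖ ^ 2) (ν.prod volume) := by
    refine integrable_prod_heatKernel_smul (F := ℝ) hν ht (by fun_prop)
      (C := 3 * (1 + ‖a‖ ^ 2)) fun q => ?_
    rw [Real.norm_of_nonneg (by positivity)]
    have h : ‖q.2 - a‖ ≤ ‖q.1‖ + ‖q.2 - q.1‖ + ‖a‖ := by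
      refine (norm_sub_le _ _).trans ?_
      gcongr
      simpa using norm_add_le q.1 (q.2 - q.1)
    have h2 : ‖q.2 - a‖ ^ 2 ≤ 3 * (‖q.1‖ ^ 2 + ‖q.2 - q.1‖ ^ 2 + ‖a‖ ^ 2) := by
      have := pow_le_pow_left₀ (norm_nonneg _) h 2
      nlinarith [sq_nonneg (‖q.1‖ - ‖q.2 - q.1‖), sq_nonneg (‖q.1‖ - ‖a‖),
        sq_nonneg (‖q.2 - q.1‖ - ‖a‖)]
    refine h2.trans ?_
    rw [mul_assoc]
    gcongr
    have h3 : 0 ≤ ‖q.1‖ ^ 2 := by positivity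
    have h4 : 0 ≤ ‖q.2 - q.1‖ ^ 2 := by positivity
    have h5 : 0 ≤ ‖a‖ ^ 2 := by positivity
    nlinarith [mul_nonneg h3 h4, mul_nonneg h5 h3, mul_nonneg h5 h4,
      mul_nonneg h5 (mul_nonneg h3 h4)]
  have e : ∀ y, ∫ w, heatKernel t (y - w) * ‖y - a‖ ^ 2 ∂ν = heatDensity ν t y * ‖y - a‖ ^ 2 :=
    fun y => by rw [integral_mul_const]; rfl
  refine ⟨hi.integral_prod_right.congr (Filter.Eventually.of_forall e), ?_⟩
  simp_rw [← e]
  rw [← integral_integral_swap (f := fun w y => heatKernel t (y - w) * ‖y - a‖ ^ 2) hi]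
  have s (w : EuclideanSpace ℝ (Fin n)) :
      ∫ y, heatKernel t (y - w) * ‖y - a‖ ^ 2 = n * t + ‖w - a‖ ^ 2 := by
    rw [← integral_heatKernel_mul_norm_add_sq ht,
      ← integral_sub_right_eq_self (fun y => heatKernel t y * ‖y + (w - a)‖ ^ 2) w]
    simp
  simp_rw [s]
  have := integrable_norm_sub_sq hν a
  simp_rw [norm_sub_rev a] at this
  rw [integral_add (integrable_const _) this]
  simp

lemma integral_norm_sub_sq {ν : Measure (EuclideanSpace ℝ (Fin n))}
    [IsProbabilityMeasure ν] (hν : Integrable (fun w => ‖w‖ ^ 2) ν)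
    (y : EuclideanSpace ℝ (Fin n)) :
    ∫ w, ‖y - w‖ ^ 2 ∂ν = ‖y - ∫ w, w ∂ν‖ ^ 2 + ∫ w, ‖w - ∫ w, w ∂ν‖ ^ 2 ∂ν := by
  set a := ∫ w, w ∂ν with ha
  have hid : Integrable (fun w => w) ν := MemLp.integrable one_le_two
    ((memLp_two_iff_integrable_sq_norm (by fun_prop)).2 hν)
  have hd : Integrable (fun w => w - a) ν := hid.sub (integrable_const _)
  have h0 : ∫ w, (w - a) ∂ν = 0 := by
    rw [integral_sub hid (integrable_const _)]; simp [ha]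
  have h1 := integral_inner (𝕜 := ℝ) hd (y - a)
  rw [h0, inner_zero_right] at h1
  have e : ∀ w, ‖y - w‖ ^ 2 = ‖y - a‖ ^ 2 - 2 * inner ℝ (y - a) (w - a) + ‖w - a‖ ^ 2 := by
    intro w
    rw [show y - w = (y - a) - (w - a) by abel, norm_sub_sq_real]
  have h2 := integrable_norm_sub_sq hν a
  simp_rw [norm_sub_rev a] at h2
  have h3 := (hd.const_inner (𝕜 := ℝ) (y - a)).const_mul 2
  have h4 : Integrable (fun w => ‖y - a‖ ^ 2 - 2 * inner ℝ (y - a) (w - a)) ν :=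
    (integrable_const _).sub h3
  rw [integral_congr_ae (Filter.Eventually.of_forall e), integral_add h4 h2,
    integral_sub (integrable_const _) h3, integral_const_mul, h1]
  simp

lemma integrable_heatDensity {ν : Measure (EuclideanSpace ℝ (Fin n))}
    [IsProbabilityMeasure ν] (hν : Integrable (fun w => ‖w‖ ^ 2) ν) (ht : 0 < t) :
    Integrable (heatDensity ν t) ∧ ∫ y, heatDensity ν t y = 1 := by
  have hi : Integrable (fun q : EuclideanSpace ℝ (Fin n) × EuclideanSpace ℝ (Fin n) =>
      heatKernel t (q.2 - q.1)) (ν.prod volume) := by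
    simpa using integrable_prod_heatKernel_smul (F := ℝ) hν ht (v := fun _ => 1) (by fun_prop)
      (C := 1) fun q => by
        rw [norm_one, one_mul]
        nlinarith [mul_nonneg (sq_nonneg ‖q.1‖) (sq_nonneg ‖q.2 - q.1‖), sq_nonneg ‖q.1‖,
          sq_nonneg ‖q.2 - q.1‖]
  refine ⟨hi.integral_prod_right, ?_⟩
  unfold heatDensity
  rw [← integral_integral_swap (f := fun w y => heatKernel t (y - w)) hi]
  have s0 (w : EuclideanSpace ℝ (Fin n)) : ∫ y, heatKernel t (y - w) = 1 := by
    rw [integral_sub_right_eq_self (fun y => heatKernel t y) w, integral_heatKernel ht]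
  simp [s0]

/-- The maximum-entropy type lower bound that makes the mutual information `O(1 / t)`. -/
lemma le_integral_heatDensity_mul_log {ν : Measure (EuclideanSpace ℝ (Fin n))}
    [IsProbabilityMeasure ν] (hν : Integrable (fun w => ‖w‖ ^ 2) ν) (ht : 0 < t) :
    -(n : ℝ) / 2 * Real.log (2 * Real.pi * t) - n / 2 - (∫ w, ‖w - ∫ w, w ∂ν‖ ^ 2 ∂ν) / t ≤
      ∫ y, heatDensity ν t y * Real.log (heatDensity ν t y) := by
  set a := ∫ w, w ∂ν with ha
  set V := ∫ w, ‖w - a‖ ^ 2 ∂ν with hV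
  set L := -(n : ℝ) / 2 * Real.log (2 * Real.pi * t) with hLdef
  obtain ⟨h1, h2⟩ := integral_heatDensity_mul_norm_sub_sq hν ht a
  obtain ⟨h3, h4⟩ := integrable_heatDensity hν ht
  have h5 : Integrable fun y => (L - V / (2 * t)) * heatDensity ν t y -
      (1 / (2 * t)) * (heatDensity ν t y * ‖y - a‖ ^ 2) := (h3.const_mul _).sub (h1.const_mul _)
  -- Jensen's bound is averaged against `p_t`. The variance `V` enters twice with weight `1 / (2t)`:
  -- once from Jensen's bound at `y`, once from the spread of `Y` itself. Hence `V / t`.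
  have h6 := integral_mono h5 (integrable_heatDensity_mul_log hν ht) fun y => by
    have h7 := le_log_heatDensity hν ht y
    rw [integral_norm_sub_sq hν y] at h7
    refine le_trans (le_of_eq ?_)
      (mul_le_mul_of_nonneg_left h7 (heatDensity_pos (ν := ν) ht y).le)
    simp only [← ha, ← hV, ← hLdef]
    ring
  rw [integral_sub (h3.const_mul _) (h1.const_mul _), integral_const_mul, integral_const_mul,
    h2, h4] at h6
  refine le_trans (le_of_eq ?_) h6
  simp only [← hV]
  field_simp
  ring

end mutualInfo

/-! ### Integration over the noise level and assembly. -/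

section main

variable {Ω : Type*} [MeasurableSpace Ω] {μ : Measure Ω} [IsProbabilityMeasure μ] {n : ℕ}
  {W : Ω → EuclideanSpace ℝ (Fin n)} {Z : ℝ → Ω → EuclideanSpace ℝ (Fin n)}

/-- The integral representation of the mutual information of the Gaussian channel. -/
lemma integrableOn_and_mutualInfo_toReal_eq (hW : Measurable W)
    (hZ : ∀ t : ℝ, 0 < t → Measurable (Z t))
    (hlaw : ∀ t : ℝ, 0 < t →
      μ.map (Z t) = multivariateGaussian 0 (t • (1 : Matrix (Fin n) (Fin n) ℝ)))
    (hWZ : ∀ t : ℝ, 0 < t → IndepFun W (Z t) μ) (hL : MemLp W 2 μ) {T : ℝ} (hT : 0 < T) :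
    IntegrableOn (fun t : ℝ => n / t - fisherInfo (W + Z t) μ) (Ioi T) ∧
      (mutualInfo W (W + Z T) μ).toReal =
        1 / 2 * ∫ t in Ioi T, (n / t - fisherInfo (W + Z t) μ) := by
  have hν := hL.integrable_norm_sq_map hW
  have : IsProbabilityMeasure (μ.map W) := Measure.isProbabilityMeasure_map hW.aemeasurable
  set I : ℝ → ℝ := fun t => -(n : ℝ) / 2 * Real.log (2 * Real.pi * t) - n / 2 -
    ∫ y, heatDensity (μ.map W) t y * Real.log (heatDensity (μ.map W) t y) with hI
  have hIeq : ∀ t, 0 < t → (mutualInfo W (W + Z t) μ).toReal = I t := fun t ht =>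
    (mutualInfo_add_ne_top_and_toReal ht hW (hZ t ht) (hlaw t ht) (hWZ t ht) hL).2
  have hderiv : ∀ t ∈ Ici T, HasDerivAt I (-(1 / 2) * (n / t - fisherInfo (W + Z t) μ)) t := by
    intro t htT
    have ht : 0 < t := hT.trans_le htT
    rw [fisherInfo_add ht hW (hZ t ht) (hlaw t ht) (hWZ t ht)]
    have h1 : HasDerivAt (fun s : ℝ => 2 * Real.pi * s) (2 * Real.pi) t := by
      simpa using (hasDerivAt_id t).const_mul (2 * Real.pi)
    refine ((((h1.log (by positivity)).const_mul (-(n : ℝ) / 2)).sub_const (n / 2 : ℝ)).sub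
      (hasDerivAt_integral_heatDensity_mul_log hν ht)).congr_deriv ?_
    field_simp
    ring
  have hneg : ∀ t ∈ Ioi T, -(1 / 2) * (n / t - fisherInfo (W + Z t) μ) ≤ 0 := by
    intro t htT
    have ht : 0 < t := hT.trans htT
    rw [div_sub_fisherInfo_eq_mmse ht hW (hZ t ht) (hlaw t ht) (hWZ t ht) hL]
    have : 0 ≤ mmse W (W + Z t) μ / t ^ 2 :=
      div_nonneg (integral_nonneg fun ω => by positivity) (by positivity)
    linarith
  -- Squeezed between `0`, as a divergence, and `V / t`.
  have hlim : Filter.Tendsto I Filter.atTop (nhds 0) := by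
    have h0 : Filter.Tendsto (fun t : ℝ => (∫ w, ‖w - ∫ w, w ∂(μ.map W)‖ ^ 2 ∂(μ.map W)) / t)
        Filter.atTop (nhds 0) := Filter.Tendsto.div_atTop tendsto_const_nhds Filter.tendsto_id
    refine tendsto_of_tendsto_of_tendsto_of_le_of_le' tendsto_const_nhds h0 ?_ ?_
    · filter_upwards [Filter.eventually_gt_atTop 0] with t ht
      rw [← hIeq t ht]
      exact ENNReal.toReal_nonneg
    · filter_upwards [Filter.eventually_gt_atTop 0] with t ht
      have := le_integral_heatDensity_mul_log hν ht
      simp only [hI]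
      linarith
  -- A derivative of constant sign whose primitive has a limit is integrable, so no separate bound
  -- on `n / t - J` is needed.
  have hint := integrableOn_Ioi_deriv_of_nonpos' hderiv hneg hlim
  have hval := integral_Ioi_of_hasDerivAt_of_nonpos' hderiv hneg hlim
  refine ⟨?_, ?_⟩
  · have := hint.const_mul (-2)
    refine this.congr (Filter.Eventually.of_forall fun t => ?_)
    simp only
    ring
  · rw [hIeq T hT]
    rw [integral_const_mul] at hval
    linarith

lemma gaussianChannel_pointwise (hW : Measurable W) {Z : Ω → EuclideanSpace ℝ (Fin n)} {t : ℝ}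
    (ht : 0 < t) (hZ : Measurable Z)
    (hlaw : μ.map Z = multivariateGaussian 0 (t • (1 : Matrix (Fin n) (Fin n) ℝ)))
    (hWZ : IndepFun W Z μ) (hL : MemLp W 2 μ) :
    HasFiniteFisherInfo (W + Z) μ ∧ 0 ≤ n / t - fisherInfo (W + Z) μ ∧
      n / t - fisherInfo (W + Z) μ = mmse W (W + Z) μ / t ^ 2 ∧
      mmse W (W + Z) μ / t ^ 2 ≤ (covMat W μ).trace / t ^ 2 := by
  have h := div_sub_fisherInfo_eq_mmse ht hW hZ hlaw hWZ hL
  refine ⟨hasFiniteFisherInfo_add ht hW hZ hlaw hWZ hL, ?_, h, ?_⟩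
  · rw [h]
    exact div_nonneg (integral_nonneg fun ω => by positivity) (by positivity)
  · have := mmse_le_trace_covMat ht hW hZ hlaw hWZ hL
    gcongr

end main

theorem mainTheorem2 {Ω : Type*} [MeasurableSpace Ω] (μ : Measure Ω) [IsProbabilityMeasure μ]
    {n : ℕ} (X : Ω → EuclideanSpace ℝ (Fin n)) (hX : Measurable X)
    (Z : ℝ → Ω → EuclideanSpace ℝ (Fin n))
    (hZ : ∀ t : ℝ, 0 < t → Measurable (Z t))
    (hZlaw : ∀ t : ℝ, 0 < t →
      μ.map (Z t) = multivariateGaussian 0 (t • (1 : Matrix (Fin n) (Fin n) ℝ)))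
    (hXZ : ∀ t : ℝ, 0 < t → IndepFun X (Z t) μ) :
    -- the channel `Y_t = X + Z_t`
    (MemLp X 2 μ →
      (∀ t : ℝ, 0 < t →
        HasFiniteFisherInfo (X + Z t) μ ∧
        0 ≤ n / t - fisherInfo (X + Z t) μ ∧
        n / t - fisherInfo (X + Z t) μ = mmse X (X + Z t) μ / t ^ 2 ∧
        mmse X (X + Z t) μ / t ^ 2 ≤ (covMat X μ).trace / t ^ 2) ∧
      (∀ T : ℝ, 0 < T →
        IntegrableOn (fun t : ℝ => n / t - fisherInfo (X + Z t) μ) (Ioi T) ∧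
        mutualInfo X (X + Z T) μ ≠ ⊤ ∧
        (mutualInfo X (X + Z T) μ).toReal =
          1 / 2 * ∫ t in Ioi T, (n / t - fisherInfo (X + Z t) μ))) ∧
    -- the channel `Y_t = f(X) + Z_t`
    (∀ f : EuclideanSpace ℝ (Fin n) → EuclideanSpace ℝ (Fin n), Measurable f →
      (∀ t : ℝ, 0 < t →
        mutualInfo X (f ∘ X + Z t) μ = mutualInfo (f ∘ X) (f ∘ X + Z t) μ) ∧
      (MemLp (f ∘ X) 2 μ →
        (∀ t : ℝ, 0 < t →
          HasFiniteFisherInfo (f ∘ X + Z t) μ ∧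
          0 ≤ n / t - fisherInfo (f ∘ X + Z t) μ ∧
          n / t - fisherInfo (f ∘ X + Z t) μ = mmse (f ∘ X) (f ∘ X + Z t) μ / t ^ 2 ∧
          mmse (f ∘ X) (f ∘ X + Z t) μ / t ^ 2 ≤ (covMat (f ∘ X) μ).trace / t ^ 2) ∧
        (∀ T : ℝ, 0 < T →
          IntegrableOn (fun t : ℝ => n / t - fisherInfo (f ∘ X + Z t) μ) (Ioi T) ∧
          mutualInfo X (f ∘ X + Z T) μ ≠ ⊤ ∧
          (mutualInfo X (f ∘ X + Z T) μ).toReal =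
            1 / 2 * ∫ t in Ioi T, (n / t - fisherInfo (f ∘ X + Z t) μ)))) := by
  refine ⟨fun hL => ⟨fun t ht => gaussianChannel_pointwise hX ht (hZ t ht) (hZlaw t ht) (hXZ t ht) hL,
    fun T hT => ?_⟩, fun f hf => ⟨fun t ht =>
      mutualInfo_comp_eq ht hX hf (hZ t ht) (hZlaw t ht) (hXZ t ht), fun hL => ?_⟩⟩
  · obtain ⟨h1, h2⟩ := integrableOn_and_mutualInfo_toReal_eq hX hZ hZlaw hXZ hL hT
    exact ⟨h1, (mutualInfo_add_ne_top_and_toReal hT hX (hZ T hT) (hZlaw T hT) (hXZ T hT) hL).1, h2⟩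
  · have hW : Measurable (f ∘ X) := hf.comp hX
    have hWZ : ∀ t : ℝ, 0 < t → IndepFun (f ∘ X) (Z t) μ := fun t ht =>
      (hXZ t ht).comp hf measurable_id
    refine ⟨fun t ht => gaussianChannel_pointwise hW ht (hZ t ht) (hZlaw t ht) (hWZ t ht) hL,
      fun T hT => ?_⟩
    obtain ⟨h1, h2⟩ := integrableOn_and_mutualInfo_toReal_eq hW hZ hZlaw hWZ hL hT
    -- Only `W = f(X)` has a second moment here; passing to `I(W; Y)` is free of moment conditions.
    rw [mutualInfo_comp_eq hT hX hf (hZ T hT) (hZlaw T hT) (hXZ T hT)]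
    exact ⟨h1, (mutualInfo_add_ne_top_and_toReal hT hW (hZ T hT) (hZlaw T hT) (hWZ T hT) hL).1, h2⟩
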